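/- Let $T\colon[0,1]\to[0,1]$ be the Farey map, $T(x)=x/(1-x)$ for $0\le x\le 1/2$ and $T(x)=(1-x)/x$ for $1/2<x\le 1$, with inverse branches $f_0(x)=x/(1+x)$, $f_1(x)=1/(1+x)$, and let $\mu_1$ be its invariant measure $d\mu_1(x)=h_1(x)\,dx$, $h_1(x)=1/x$, on $[0,1]$. Let $\mathcal P(f)=|f_0'|\cdot f\circ f_0+|f_1'|\cdot f\circ f_1$ be the Perron–Frobenius operator and $\widehat T(f)=\mathcal P(f\cdot h_1)/h_1$ the transfer operator with respect to $\mu_1$. Let $Y=[1/2,1]$, let $\phi_Y(y)=\inf\{n\ge 1: T^n(y)\in Y\}$ be the first return time (with $\inf\emptyset=\infty$), and for $n\ge1$ let $$R_n(f)=\mathbf 1_Y\cdot\widehat T^{\,n}\big(\mathbf 1_{\overline{\{y\in Y:\phi_Y(y)=n\}}}\cdot f\big),$$ an operator on $L^1(\mu_1)$, i.e. acting on functions up to $\mu_1$-null sets. Let $\mathrm{BV}(Y)$ be the space of right-continuous functions $f\colon[0,1]\to\mathbb C$ that vanish outside $Y$ and have bounded variation on $Y$, with the norm $\|f\|_{\mathrm{BV}}=\sup_{x\in[0,1]}|f(x)|+V_Y(f)$.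 Then $\mathrm{BV}(Y)$ is a Banach space of $\mu_1$-integrable functions, and the operators $R_n$ restrict to bounded linear operators on $\mathrm{BV}(Y)$, also denoted $R_n$: for $f\in\mathrm{BV}(Y)$ the class of $R_n(f)$ has a representative in $\mathrm{BV}(Y)$, which is unique on $[0,1)$ and is normalised at the endpoint $1$ (where right-continuity is an empty condition) by continuity at $1$. For every $z\in\mathbb C$ with $|z|\le1$ the series $R(z)=\sum_{n\ge1}z^nR_n$ converges in operator norm on $\mathrm{BV}(Y)$, and for each $f\in\mathrm{BV}(Y)$ the series $\sum_{n\ge 1} z^nR_n(f)$ converges to $R(z)(f)$ in $L^1(\mu_1)$. Moreover: - (R1) if $f\in\mathrm{BV}(Y)$, then $f\in L^\infty([0,1])$ and $R(1)(f)\in\mathrm{BV}(Y)$; - (R2) $\|f\|_{L^\infty}\le\|f\|_{\mathrm{BV}}$ for all $f\in\mathrm{BV}(Y)$, where $\|\cdot\|_{L^\infty}$ is the essential supremum with respect to Lebesgue measure on $[0,1]$; - (R3) there is a constant $C>0$ such that the operator norms on $\mathrm{BV}(Y)$ satisfy $\|R_n\|\le C\,\mu_1(\{y\in Y:\phi_Y(y)=n\})$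 for all $n\ge1$; - (R4) $1$ is a simple isolated eigenvalue of $R(1)\colon\mathrm{BV}(Y)\to\mathrm{BV}(Y)$: it is an isolated point of the spectrum, its eigenspace is one-dimensional, and the eigenspace has a closed $R(1)$-invariant complement on which $R(1)-1$ is bijective; - (R5) for every $z\in\mathbb C$ with $|z|\le1$ and $z\ne1$, the value $1$ is not in the spectrum of $R(z)\colon\mathrm{BV}(Y)\to\mathrm{BV}(Y)$. -/

import Mathlib

open MeasureTheory Filter Topology Set
open scoped ENNReal NNReal

noncomputable section

namespace Farey

/-! ### The Farey map, its invariant measure and its transfer operator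

A function on `[0,1]` vanishing outside `Y = [1/2,1]` is represented by its extension by zero
to `ℝ`; every notion below only refers to its values on `[0,1]`. -/

/-- The Farey map of `[0,1]`. -/
def fareyMap (x : ℝ) : ℝ := if x ≤ 1 / 2 then x / (1 - x) else (1 - x) / x

/-- The inverse branch `[0,1] → [0,1/2]`. -/
def branch0 (x : ℝ) : ℝ := x / (1 + x)

/-- The inverse branch `[0,1] → [1/2,1]`. -/
def branch1 (x : ℝ) : ℝ := 1 / (1 + x)

/-- The invariant density. -/
def density (x : ℝ) : ℝ := 1 / x

/-- The (infinite) invariant measure `dμ₁ = dx / x` on `[0,1]`. -/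
def mu1 : Measure ℝ :=
  (volume.restrict (Icc 0 1)).withDensity (fun x => ENNReal.ofReal (density x))

/-- The Perron–Frobenius operator of the Farey map (with respect to Lebesgue measure). -/
def perronFrobenius (f : ℝ → ℂ) (x : ℝ) : ℂ :=
  (|deriv branch0 x| : ℝ) * f (branch0 x) + (|deriv branch1 x| : ℝ) * f (branch1 x)

/-- The transfer operator with respect to `μ₁`. -/
def transferOp (f : ℝ → ℂ) (x : ℝ) : ℂ :=
  perronFrobenius (fun y => f y * (density y : ℂ)) x / (density x : ℂ)

/-- The inducing set `Y = [1/2, 1]`. -/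
def Y : Set ℝ := Icc (1 / 2) 1

/-- The first return time to `Y`, equal to `⊤` at points that never return. -/
def returnTime (y : ℝ) : ℕ∞ :=
  sInf ((fun n : ℕ => (n : ℕ∞)) '' {n : ℕ | 1 ≤ n ∧ fareyMap^[n] y ∈ Y})

/-- The set `{y ∈ Y : φ_Y(y) = n}`. -/
def levelSet (n : ℕ) : Set ℝ := {y | y ∈ Y ∧ returnTime y = n}

/-- The first return time operator `f ↦ 𝟙_Y · T̂ⁿ (𝟙_{closure {φ_Y = n}} · f)`. -/
def firstReturnOp (n : ℕ) (f : ℝ → ℂ) : ℝ → ℂ :=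
  Y.indicator (transferOp^[n] ((closure (levelSet n)).indicator f))

/-! ### The space `BV(Y)` -/

theorem eVariationOn_add_le (f g : ℝ → ℂ) (s : Set ℝ) :
    eVariationOn (f + g) s ≤ eVariationOn f s + eVariationOn g s := by
  apply iSup_le
  rintro ⟨n, ⟨u, hu, us⟩⟩
  calc ∑ i ∈ Finset.range n, edist ((f + g) (u (i + 1))) ((f + g) (u i))
      ≤ ∑ i ∈ Finset.range n,
          (edist (f (u (i + 1))) (f (u i)) + edist (g (u (i + 1))) (g (u i))) :=
        Finset.sum_le_sum fun i _ => edist_add_add_le _ _ _ _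
    _ = _ := Finset.sum_add_distrib
    _ ≤ _ := add_le_add (eVariationOn.sum_le hu us) (eVariationOn.sum_le hu us)

theorem eVariationOn_const_smul (c : ℂ) (f : ℝ → ℂ) (s : Set ℝ) :
    eVariationOn (c • f) s = ‖c‖ₑ * eVariationOn f s := by
  unfold eVariationOn
  rw [ENNReal.mul_iSup]
  refine iSup_congr fun p => ?_
  rw [Finset.mul_sum]
  refine Finset.sum_congr rfl fun i _ => ?_
  simp only [Pi.smul_apply, edist_eq_enorm_sub, ← smul_sub, enorm_smul]

/-- The functions on `[0,1]` that vanish outside `Y`, are right-continuous on `[0,1]` and have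
bounded variation. (Right-continuity is an empty condition at the right endpoint `1`.) -/
def bvSubmodule : Submodule ℂ (ℝ → ℂ) where
  carrier := {f | (∀ x, x ∉ Y → f x = 0) ∧
    (∀ x ∈ Icc (0 : ℝ) 1, ContinuousWithinAt f (Icc x 1) x) ∧ BoundedVariationOn f Y}
  zero_mem' := by
    refine ⟨fun _ _ => rfl, fun _ _ => continuousWithinAt_const, ?_⟩
    have := eVariationOn_const_smul 0 0 Y
    simp only [smul_zero, enorm_zero, zero_mul] at this
    simp [BoundedVariationOn, this]
  add_mem' := by
    rintro f g ⟨hf0, hf1, hf2⟩ ⟨hg0, hg1, hg2⟩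
    refine ⟨fun x hx => by simp [hf0 x hx, hg0 x hx], fun x hx => (hf1 x hx).add (hg1 x hx), ?_⟩
    exact ne_top_of_le_ne_top (ENNReal.add_ne_top.2 ⟨hf2, hg2⟩) (eVariationOn_add_le f g Y)
  smul_mem' := by
    rintro c f ⟨hf0, hf1, hf2⟩
    refine ⟨fun x hx => by simp [hf0 x hx], fun x hx => (hf1 x hx).const_smul c, ?_⟩
    rw [BoundedVariationOn, eVariationOn_const_smul]
    exact ENNReal.mul_ne_top enorm_ne_top hf2

/-- The space `BV(Y)`. -/
def BVY : Type := bvSubmodule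

instance : AddCommGroup BVY := inferInstanceAs (AddCommGroup bvSubmodule)

instance : Module ℂ BVY := inferInstanceAs (Module ℂ bvSubmodule)

instance : CoeFun BVY (fun _ => ℝ → ℂ) := ⟨fun f => f.1⟩

/-- The norm `‖f‖_∞ + V_Y(f)`, with the pointwise supremum over `[0,1]`. -/
instance : Norm BVY :=
  ⟨fun f => (⨆ x : Icc (0 : ℝ) 1, ‖f x‖) + (eVariationOn f Y).toReal⟩

theorem BVY.norm_def (f : BVY) :
    ‖f‖ = (⨆ x : Icc (0 : ℝ) 1, ‖f x‖) + (eVariationOn f Y).toReal := rfl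

theorem BVY.bddAbove (f : BVY) : BddAbove (range fun x : Icc (0 : ℝ) 1 => ‖f x‖) := by
  refine ⟨‖f 1‖ + (eVariationOn f Y).toReal, ?_⟩
  rintro _ ⟨x, rfl⟩
  by_cases hx : (x : ℝ) ∈ Y
  · have h1 : (1 : ℝ) ∈ Y := ⟨by norm_num, le_rfl⟩
    have h2 := f.2.2.2.dist_le hx h1
    rw [dist_eq_norm] at h2
    have h3 := norm_add_le (f 1) (f x - f 1)
    rw [add_sub_cancel] at h3
    simp only
    linarith
  · simp only [f.2.1 x hx, norm_zero]
    positivity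

theorem BVY.core : NormedSpace.Core ℂ BVY where
  norm_nonneg f := by
    rw [BVY.norm_def]
    exact add_nonneg (Real.iSup_nonneg fun _ => norm_nonneg _) ENNReal.toReal_nonneg
  norm_smul c f := by
    have h : ((c • f : BVY) : ℝ → ℂ) = c • (f : ℝ → ℂ) := rfl
    rw [BVY.norm_def, BVY.norm_def, h, eVariationOn_const_smul, ENNReal.toReal_mul, mul_add,
      Real.mul_iSup_of_nonneg (norm_nonneg c)]
    simp
  norm_triangle f g := by
    have h : ((f + g : BVY) : ℝ → ℂ) = (f : ℝ → ℂ) + (g : ℝ → ℂ) := rfl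
    rw [BVY.norm_def, BVY.norm_def, BVY.norm_def, h]
    have hs : (⨆ x : Icc (0 : ℝ) 1, ‖((f : ℝ → ℂ) + (g : ℝ → ℂ)) x‖) ≤
        (⨆ x : Icc (0 : ℝ) 1, ‖f x‖) + ⨆ x : Icc (0 : ℝ) 1, ‖g x‖ := by
      have : Nonempty (Icc (0 : ℝ) 1) := ⟨⟨0, by simp⟩⟩
      refine ciSup_le fun x => (norm_add_le _ _).trans ?_
      exact add_le_add (le_ciSup f.bddAbove x) (le_ciSup g.bddAbove x)
    have hv := ENNReal.toReal_mono (ENNReal.add_ne_top.2 ⟨f.2.2.2, g.2.2.2⟩)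
      (eVariationOn_add_le f g Y)
    rw [ENNReal.toReal_add f.2.2.2 g.2.2.2] at hv
    linarith
  norm_eq_zero_iff f := by
    constructor
    · intro hf
      rw [BVY.norm_def] at hf
      have h1 : 0 ≤ ⨆ x : Icc (0 : ℝ) 1, ‖f x‖ := Real.iSup_nonneg fun _ => norm_nonneg _
      have h2 : 0 ≤ (eVariationOn f Y).toReal := ENNReal.toReal_nonneg
      refine Subtype.ext (funext fun x => ?_)
      by_cases hx : x ∈ Y
      · have hx' : x ∈ Icc (0 : ℝ) 1 := ⟨by have := hx.1; linarith, hx.2⟩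
        have h3 : ‖f x‖ ≤ _ := le_ciSup f.bddAbove ⟨x, hx'⟩
        have h4 : ‖f x‖ ≤ 0 := by linarith
        exact norm_le_zero_iff.1 h4
      · exact f.2.1 x hx
    · rintro rfl
      have h : ((0 : BVY) : ℝ → ℂ) = (0 : ℂ) • (0 : ℝ → ℂ) := by rw [zero_smul]; rfl
      rw [BVY.norm_def, h, eVariationOn_const_smul]
      simp

instance : NormedAddCommGroup BVY := NormedAddCommGroup.ofCore BVY.core

instance : NormedSpace ℂ BVY := NormedSpace.ofCore BVY.core

/-! ### Restrictions to `BV(Y)` and spectral notions -/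

/-- `L` is the operator induced on `BV(Y)` by the operator `A`, which acts on functions up to
`μ₁`-null sets: `L f` is the representative in `BV(Y)` of the class of `A f`. Right-continuity
determines that representative on `[0,1)`; at the endpoint `1`, where right-continuity says
nothing, it is normalised to be continuous. -/
def IsRestriction (A : (ℝ → ℂ) → (ℝ → ℂ)) (L : BVY →L[ℂ] BVY) : Prop :=
  ∀ f : BVY, (L f : ℝ → ℂ) =ᵐ[mu1] A f ∧ Tendsto (L f : ℝ → ℂ) (𝓝[<] 1) (𝓝 (L f 1))

/-- `R(z) = ∑_{n ≥ 1} zⁿ Rₙ`. -/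
def genOp (R : ℕ+ → BVY →L[ℂ] BVY) (z : ℂ) : BVY →L[ℂ] BVY := ∑' n : ℕ+, z ^ (n : ℕ) • R n

/-- `a` is a simple isolated eigenvalue of `L`: it is an isolated point of the spectrum, the
eigenspace is one-dimensional, and the eigenspace has a closed `L`-invariant complement on which
`L - a` is bijective (so that the spectral projection at `a` has rank one). -/
def IsSimpleIsolatedEigenvalue {E : Type*} [NormedAddCommGroup E] [NormedSpace ℂ E]
    (L : E →L[ℂ] E) (a : ℂ) : Prop :=
  (∃ ε > 0, spectrum ℂ L ∩ Metric.ball a ε = {a}) ∧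
  Module.finrank ℂ (Module.End.eigenspace (L : E →ₗ[ℂ] E) a) = 1 ∧
  ∃ H : Submodule ℂ E, IsClosed (H : Set E) ∧
    IsCompl (Module.End.eigenspace (L : E →ₗ[ℂ] E) a) H ∧
    MapsTo L H H ∧ BijOn (fun f => L f - a • f) H H

end Farey

end

/-! The map induced on `Y` has full branches. The inverse branch with return time `k + 1` is the
decreasing map `branch k` onto `[cut k, cut (k + 1)]`, and `R_{k+1}` is composition with it,
weighted by `weight k`. The weights telescope, `weight k x = 1/(1+kx) - 1/(1+(k+1)x)`, so for each
`x` they form a probability vector and `R(1)` is an averaging operator fixing constants. Each weight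
is of the order of the length of its cell, in size and in variation, which gives summable norms and
the bound of `‖R_n‖` by the measure of the level set.

Eigenvalue 1 of `R(1)`: averages of an increasing function decrease in `x`, because the branches
decrease and because the tail mass `1/(1+Nx)` of the weights decreases. Applied to the variation
function of `f`, perturbed by the real part of a rotation of `f`, this bounds the variation of `R(1)
f` by the drop of one average between `1/2` and `1`. Since `branch k (1/2) = branch (k + 1) 1`, that
drop is at most half the variation of `f`. Thus `R(1)` contracts the variation seminorm, whose
kernel is the constants, and its powers converge to a rank-one projection
(`isSimpleIsolatedEigenvalue_of_seminorm`).

For `z ≠ 1` there is an inequality of Lasota-Yorke type, `var (R(z) f) ≤ var f / 2 + 4 sup |f|`.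
When the variation is controlled by the supremum, two consecutive terms of the series must partly
cancel: by pigeonhole `f` is nearly equal at two neighbouring branch points, and `|1 + z| < 2`. So
the supremum strictly decreases, and `R(z)` contracts a gauge equivalent to the norm.

The branches reverse orientation, so right-continuity is lost pointwise. It is restored by taking
right limits, which alters only a null set and increases neither supremum nor variation. -/

namespace Farey

/-! ### Spectral consequences of contraction in an abstract Banach space -/

section Spectral

variable {E : Type*} [NormedAddCommGroup E] [NormedSpace ℂ E] [CompleteSpace E]

/-- If `L` contracts by a factor `θ` some gauge equivalent to the norm, then `a - L` is invertible
for `θ < ‖a‖`. -/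
theorem isUnit_algebraMap_sub_of_contraction (L : E →L[ℂ] E) (p : E → ℝ) {A B θ : ℝ}
    (hB0 : 0 ≤ B) (hA : ∀ f, p f ≤ A * ‖f‖) (hB : ∀ f, ‖f‖ ≤ B * p f)
    (hθ : 0 ≤ θ) (h : ∀ f, p (L f) ≤ θ * p f) {a : ℂ} (ha : θ < ‖a‖) :
    IsUnit (algebraMap ℂ (E →L[ℂ] E) a - L) := by
  have ha0 : 0 < ‖a‖ := hθ.trans_lt ha
  have ha' : a ≠ 0 := norm_pos_iff.1 ha0
  have hpow : ∀ k f, p ((L ^ k) f) ≤ θ ^ k * p f := by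
    intro k
    induction k with
    | zero => intro f; simp
    | succ k ih =>
      intro f
      rw [pow_succ', mul_apply_eq_comp, pow_succ', mul_assoc]
      exact (h _).trans (mul_le_mul_of_nonneg_left (ih f) hθ)
  set M : E →L[ℂ] E := a⁻¹ • L with hM
  have hbound : ∀ k f, ‖(M ^ k) f‖ ≤ B * A * (θ / ‖a‖) ^ k * ‖f‖ := by
    intro k f
    rw [hM, smul_pow, _root_.smul_apply, norm_smul, norm_pow, norm_inv, div_pow]
    have h1 : ‖(L ^ k) f‖ ≤ B * (θ ^ k * (A * ‖f‖)) :=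
      (hB _).trans (mul_le_mul_of_nonneg_left
        ((hpow k f).trans (mul_le_mul_of_nonneg_left (hA f) (pow_nonneg hθ k))) hB0)
    calc ‖a‖⁻¹ ^ k * ‖(L ^ k) f‖ ≤ ‖a‖⁻¹ ^ k * (B * (θ ^ k * (A * ‖f‖))) := by gcongr
      _ = _ := by rw [inv_pow]; field_simp
  have hlim : Tendsto (fun k : ℕ => B * A * (θ / ‖a‖) ^ k) atTop (𝓝 0) := by
    simpa using (tendsto_pow_atTop_nhds_zero_of_lt_one (by positivity)
      ((div_lt_one ha0).2 ha)).const_mul (B * A)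
  obtain ⟨k, hk⟩ := (hlim.eventually (gt_mem_nhds one_half_pos)).exists
  have hMk : ‖M ^ k‖ < 1 := by
    refine (ContinuousLinearMap.opNorm_le_bound _ one_half_pos.le fun f => ?_).trans_lt
      one_half_lt_one
    exact (hbound k f).trans (mul_le_mul_of_nonneg_right hk.le (norm_nonneg f))
  -- `1 - M ^ k` is `1 - M` times a geometric sum; the factors commute, so each is a unit.
  have hu : IsUnit (1 - M ^ k) := isUnit_one_sub_of_norm_lt_one hMk
  rw [← mul_neg_geom_sum] at hu
  have hc : Commute (1 - M) (∑ i ∈ Finset.range k, M ^ i) :=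
    Commute.sum_right _ _ _ fun i _ =>
      ((Commute.one_left _).sub_left ((Commute.refl M).pow_right i))
  have h1 : IsUnit (1 - M) := (hc.isUnit_mul_iff.1 hu).1
  have h2 : algebraMap ℂ (E →L[ℂ] E) a - L = (Units.mk0 a ha') • (1 - M) := by
    rw [Units.smul_mk0, smul_sub, hM, smul_smul, mul_inv_cancel₀ ha', one_smul,
      Algebra.algebraMap_eq_smul_one]
  rw [h2]
  exact h1.smul _

/-- An operator fixing `e`, with an invariant functional `m`, which contracts the gauge
`V + |m|`, has `1` as a simple isolated eigenvalue. -/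
theorem isSimpleIsolatedEigenvalue_of_invariant (L : E →L[ℂ] E) (e : E) (m : E →L[ℂ] ℂ)
    (hLe : L e = e) (hme : m e = 1) (hmL : ∀ f, m (L f) = m f) {θ : ℝ} (hθ : 0 ≤ θ) (hθ1 : θ < 1)
    (hQ : ∀ a : ℂ, θ < ‖a‖ → IsUnit (algebraMap ℂ (E →L[ℂ] E) a - (L - m.smulRight e))) :
    IsSimpleIsolatedEigenvalue L 1 := by
  have he : e ≠ 0 := by rintro rfl; simp at hme
  -- `Q` kills `e` and agrees with `L` on the kernel of `m`.
  set Q := L - m.smulRight e with hQdef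
  have hQa : ∀ f, Q f = L f - m f • e := fun f => rfl
  have hmQ : ∀ f, m (Q f) = 0 := fun f => by simp [hQa, hmL, hme]
  have hbij : ∀ a : ℂ, θ < ‖a‖ → Function.Bijective (fun f => a • f - Q f) := fun a ha => by
    have := ContinuousLinearMap.isUnit_iff_bijective.1 (hQ a ha)
    convert this using 1
    funext f
    simp [Algebra.algebraMap_eq_smul_one]
  have hm0 : ∀ {a : ℂ} {g f : E}, θ < ‖a‖ → a ≠ 0 → m g = 0 → a • f - Q f = g → m f = 0 := by
    intro a g f _ ha0 hg hf
    have := congrArg m hf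
    rw [map_sub, hmQ, hg, sub_zero, map_smul, smul_eq_mul] at this
    exact (mul_eq_zero.1 this).resolve_left ha0
  have hθ' : θ < ‖(1 : ℂ)‖ := by simpa using hθ1
  have hker : ∀ f, m f = 0 → L f = f → f = 0 := by
    intro f hf hLf
    refine (hbij 1 hθ').1 ?_
    simp [hQa, hf, hLf]
  have heig : ∀ f, f ∈ Module.End.eigenspace (L : E →ₗ[ℂ] E) 1 ↔ L f = f := by
    intro f; rw [Module.End.mem_eigenspace_iff]; simp
  have hspan : Module.End.eigenspace (L : E →ₗ[ℂ] E) 1 = Submodule.span ℂ {e} := by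
    ext f
    rw [heig, Submodule.mem_span_singleton]
    constructor
    · intro hf
      refine ⟨m f, (sub_eq_zero.1 (hker (f - m f • e) ?_ ?_)).symm⟩
      · simp [hme]
      · simp [hf, hLe]
    · rintro ⟨c, rfl⟩
      simp [hLe]
  -- The ball of radius `1 - θ` about `1` lies in the region `θ < ‖a‖`.
  refine ⟨⟨1 - θ, by linarith, ?_⟩, ?_, LinearMap.ker (m : E →ₗ[ℂ] ℂ), ?_, ?_, ?_, ?_⟩
  · ext a
    simp only [mem_inter_iff, Metric.mem_ball, mem_singleton_iff]
    constructor
    · rintro ⟨has, had⟩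
      by_contra ha1
      have ha : θ < ‖a‖ := by
        have h1 : ‖(1 : ℂ)‖ ≤ ‖a‖ + ‖1 - a‖ := by
          simpa using norm_add_le a (1 - a)
        rw [dist_eq_norm, norm_sub_rev] at had
        rw [norm_one] at h1
        linarith
      have ha0 : a ≠ 0 := norm_pos_iff.1 (hθ.trans_lt ha)
      apply has
      change IsUnit (algebraMap ℂ (E →L[ℂ] E) a - L)
      rw [ContinuousLinearMap.isUnit_iff_bijective]
      have hsub : ∀ f, (algebraMap ℂ (E →L[ℂ] E) a - L) f = a • f - L f := fun f => by
        simp [Algebra.algebraMap_eq_smul_one]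
      constructor
      · rw [injective_iff_map_eq_zero]
        intro f hf
        rw [hsub, sub_eq_zero] at hf
        have hmf : m f = 0 := by
          have := congrArg m hf
          rw [map_smul, hmL, smul_eq_mul] at this
          by_contra h0
          exact ha1 (mul_right_cancel₀ h0 (this.trans (one_mul _).symm))
        refine (hbij a ha).1 ?_
        simp [hQa, hmf, hf]
      · intro g
        obtain ⟨f, hf⟩ := (hbij a ha).2 (g - m g • e)
        have hmf : m f = 0 := hm0 ha ha0 (by simp [hme]) hf
        -- On the line spanned by `e`, `a - L` is multiplication by `a - 1`; the kernel of `m` is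
        -- handled by `Q`.
        refine ⟨f + (m g / (a - 1)) • e, ?_⟩
        rw [hsub, map_add, map_smul, hLe]
        simp only [hQa, hmf, zero_smul, sub_zero] at hf
        have h1 : a - 1 ≠ 0 := sub_ne_zero.2 ha1
        calc a • (f + (m g / (a - 1)) • e) - (L f + (m g / (a - 1)) • e)
            = (a • f - L f) + ((a - 1) * (m g / (a - 1))) • e := by module
          _ = g := by rw [hf, mul_div_cancel₀ _ h1]; module
    · rintro rfl
      refine ⟨?_, by simpa using hθ1⟩
      intro h
      have := (ContinuousLinearMap.isUnit_iff_bijective.1 h).1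
      apply he
      apply this
      simp [hLe]
  · rw [hspan]; exact finrank_span_singleton he
  · exact m.isClosed_ker
  · rw [hspan]
    constructor
    · rw [Submodule.disjoint_def]
      intro f hf hf'
      obtain ⟨c, rfl⟩ := Submodule.mem_span_singleton.1 hf
      have : c = 0 := by simpa [hme] using hf'
      rw [this, zero_smul]
    · rw [codisjoint_iff, Submodule.eq_top_iff']
      intro f
      refine Submodule.mem_sup.2 ⟨m f • e, Submodule.smul_mem _ _ (Submodule.mem_span_singleton_self e),
        f - m f • e, ?_, by abel⟩
      simp [hme]
  · intro f hf
    simp only [SetLike.mem_coe, LinearMap.mem_ker, ContinuousLinearMap.coe_coe] at hf ⊢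
    rw [hmL, hf]
  · refine ⟨fun f hf => ?_, fun f hf g hg hfg => ?_, fun g hg => ?_⟩
    · simp only [SetLike.mem_coe, LinearMap.mem_ker, ContinuousLinearMap.coe_coe] at hf ⊢
      simp [hmL, hf]
    · simp only [SetLike.mem_coe, LinearMap.mem_ker, ContinuousLinearMap.coe_coe] at hf hg
      refine sub_eq_zero.1 (hker (f - g) (by simp [hf, hg]) ?_)
      simp only [one_smul] at hfg
      rw [map_sub, ← sub_eq_zero, ← sub_eq_zero.2 hfg]
      abel
    · simp only [SetLike.mem_coe, LinearMap.mem_ker, ContinuousLinearMap.coe_coe] at hg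
      obtain ⟨f, hf⟩ := (hbij 1 hθ').2 (-g)
      have hmf : m f = 0 := hm0 hθ' one_ne_zero (by simp [hg]) hf
      refine ⟨f, by simpa using hmf, ?_⟩
      simp only [hQa, hmf, zero_smul, sub_zero, one_smul] at hf ⊢
      rw [← neg_sub, hf, neg_neg]

/-- If `L` contracts a seminorm controlling `L - 1`, then the powers of `L` converge to an operator
`P` with `P L = L P = P` that is close to the identity on functions of small seminorm. -/
theorem exists_limit_of_seminorm_contraction (L : E →L[ℂ] E) (V : Seminorm ℂ E)
    {θ C : ℝ} (hθ : 0 ≤ θ) (hθ1 : θ < 1) (hC : 0 ≤ C)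
    (hV : ∀ f, V f ≤ ‖f‖) (hLV : ∀ f, V (L f) ≤ θ * V f) (hL1 : ∀ f, ‖L f - f‖ ≤ C * V f) :
    ∃ P : E →L[ℂ] E, P * L = P ∧ L * P = P ∧ ∀ f, ‖P f - f‖ ≤ C * (1 - θ)⁻¹ * V f := by
  have hpow : ∀ k f, V ((L ^ k) f) ≤ θ ^ k * V f := by
    intro k
    induction k with
    | zero => intro f; simp
    | succ k ih =>
      intro f
      rw [pow_succ', mul_apply_eq_comp, pow_succ', mul_assoc]
      exact (hLV _).trans (mul_le_mul_of_nonneg_left (ih f) hθ)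
  have hterm : ∀ k f, ‖((L - 1) * L ^ k) f‖ ≤ C * θ ^ k * V f := fun k f => by
    rw [mul_assoc]
    exact (hL1 _).trans (mul_le_mul_of_nonneg_left (hpow k f) hC)
  have hgeom : Summable fun k : ℕ => C * θ ^ k :=
    (summable_geometric_of_lt_one hθ hθ1).mul_left C
  have hsum : Summable fun k : ℕ => (L - 1) * L ^ k := by
    refine Summable.of_norm_bounded hgeom fun k => ?_
    refine ContinuousLinearMap.opNorm_le_bound _ (by positivity) fun f => ?_
    exact (hterm k f).trans (mul_le_mul_of_nonneg_left (hV f) (by positivity))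
  -- The series telescopes: its partial sums are `L ^ k - 1`, so `1 + T` is the limit of the powers.
  obtain ⟨T, hT⟩ : ∃ T : E →L[ℂ] E, T = ∑' k : ℕ, (L - 1) * L ^ k := ⟨_, rfl⟩
  have hTf : ∀ f, HasSum (fun k : ℕ => ((L - 1) * L ^ k) f) (T f) := fun f => by
    have := (ContinuousLinearMap.apply ℂ E f).hasSum hsum.hasSum
    rw [← hT] at this
    simpa only [ContinuousLinearMap.apply_apply] using this
  have hTle : ∀ f, ‖T f‖ ≤ C * (1 - θ)⁻¹ * V f := fun f => by
    rw [← (hTf f).tsum_eq]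
    exact tsum_of_norm_bounded
      (((hasSum_geometric_of_lt_one hθ hθ1).mul_left C).mul_right (V f)) (hterm · f)
  have h0 : T = (L - 1) + ∑' k : ℕ, (L - 1) * L ^ (k + 1) := by
    have := hsum.tsum_eq_zero_add
    rwa [pow_zero, mul_one, ← hT] at this
  have hTL : T * L = ∑' k : ℕ, (L - 1) * L ^ (k + 1) := by
    rw [hT, ← hsum.tsum_mul_right]
    exact tsum_congr fun k => by rw [mul_assoc, pow_succ]
  have hLT : L * T = ∑' k : ℕ, (L - 1) * L ^ (k + 1) := by
    rw [hT, ← hsum.tsum_mul_left]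
    exact tsum_congr fun k => by
      rw [← mul_assoc, pow_succ', ← mul_assoc]
      congr 1
      rw [mul_sub, sub_mul, mul_one, one_mul]
  refine ⟨1 + T, ?_, ?_, fun f => by simpa using hTle f⟩
  · rw [add_mul, hTL, one_mul, h0]; abel
  · rw [mul_add, hLT, mul_one, h0]; abel

/-- An operator fixing `e` which contracts a seminorm vanishing only on the multiples of `e` and
controlling `L - 1` has `1` as a simple isolated eigenvalue. -/
theorem isSimpleIsolatedEigenvalue_of_seminorm (L : E →L[ℂ] E) (e : E) (V : Seminorm ℂ E)
    (he : e ≠ 0) (hLe : L e = e) {θ C : ℝ} (hθ : 0 ≤ θ) (hθ1 : θ < 1) (hC : 0 ≤ C)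
    (hV : ∀ f, V f ≤ ‖f‖) (hLV : ∀ f, V (L f) ≤ θ * V f) (hL1 : ∀ f, ‖L f - f‖ ≤ C * V f)
    (hV0 : ∀ f, V f = 0 → ∃ c : ℂ, f = c • e) :
    IsSimpleIsolatedEigenvalue L 1 := by
  obtain ⟨P, hPL, hLP, hP⟩ := exists_limit_of_seminorm_contraction L V hθ hθ1 hC hV hLV hL1
  have hVP : ∀ f, V (P f) = 0 := fun f => by
    have h1 : V ((L * P) f) ≤ θ * V (P f) := hLV _
    rw [hLP] at h1
    have h2 := apply_nonneg V (P f)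
    nlinarith
  have hVe : V e = 0 := by
    have h1 := hLV e
    rw [hLe] at h1
    have h2 := apply_nonneg V e
    nlinarith
  have hPe : P e = e := by
    have := hP e
    rw [hVe, mul_zero] at this
    exact sub_eq_zero.1 (norm_le_zero_iff.1 this)
  -- The seminorm vanishes on the range of `P`, so `P f` is a multiple of `e`, and `φ` reads off the
  -- coefficient.
  obtain ⟨φ, -, hφ⟩ := exists_dual_vector ℂ e (norm_ne_zero_iff.2 he)
  have hφ0 : φ e ≠ 0 := by rw [hφ]; simpa using he
  set m : E →L[ℂ] ℂ := (φ e)⁻¹ • (φ.comp P) with hm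
  have hma : ∀ f, m f = (φ e)⁻¹ * φ (P f) := fun f => rfl
  have hmP : ∀ f, P f = m f • e := fun f => by
    obtain ⟨c, hc⟩ := hV0 _ (hVP f)
    rw [hma, hc, map_smul, smul_eq_mul, mul_comm c, inv_mul_cancel_left₀ hφ0]
  have hme : m e = 1 := by
    rw [hma]
    simp [hPe, hφ0]
  have hmL : ∀ f, m (L f) = m f := fun f => by
    rw [hma, hma, ← mul_apply_eq_comp, hPL]
  have hone : ∀ f, f = m f • e - (P f - f) := fun f => by
    rw [← hmP]
    abel
  refine isSimpleIsolatedEigenvalue_of_invariant L e m hLe hme hmL hθ hθ1 fun a ha => ?_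
  have hB0 : 0 ≤ C * (1 - θ)⁻¹ := mul_nonneg hC (inv_nonneg.2 (by linarith))
  -- The constant `B` comes from `f = m f • e - (P f - f)`. After subtracting the rank-one part, the
  -- term `‖m ·‖` vanishes and only the contraction of `V` remains.
  refine isUnit_algebraMap_sub_of_contraction _ (fun f => V f + ‖m f‖) (A := 1 + ‖m‖)
    (B := ‖e‖ + C * (1 - θ)⁻¹) (by positivity) (fun f => ?_) (fun f => ?_) hθ (fun f => ?_) ha
  · rw [add_mul, one_mul]
    exact add_le_add (hV f) (m.le_opNorm f)
  · have h1 : ‖f‖ ≤ ‖m f‖ * ‖e‖ + C * (1 - θ)⁻¹ * V f := by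
      calc ‖f‖ = ‖m f • e - (P f - f)‖ := congrArg norm (hone f)
        _ ≤ ‖m f • e‖ + ‖P f - f‖ := norm_sub_le _ _
        _ ≤ _ := add_le_add (norm_smul_le _ _) (hP f)
    have h2 : 0 ≤ ‖e‖ * V f := mul_nonneg (norm_nonneg e) (apply_nonneg V f)
    have h3 : 0 ≤ C * (1 - θ)⁻¹ * ‖m f‖ := mul_nonneg hB0 (norm_nonneg _)
    linarith
  · have h1 : (L - m.smulRight e) f = L f - m f • e := rfl
    have h2 : V (L f - m f • e) ≤ V (L f) := by
      refine (map_sub_le_add V _ _).trans ?_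
      rw [map_smul_eq_mul, hVe, mul_zero, add_zero]
    have h3 : m (L f - m f • e) = 0 := by simp [hmL, hme]
    simp only [h1, h3, norm_zero, add_zero]
    have h4 : 0 ≤ θ * ‖m f‖ := by positivity
    linarith [hLV f]

end Spectral

/-! ### The measure `μ₁` on `Y` -/

theorem measurableSet_Y : MeasurableSet Y := measurableSet_Icc

theorem one_mem_Y : (1 : ℝ) ∈ Y := ⟨by norm_num, le_rfl⟩

theorem half_mem_Y : (1 / 2 : ℝ) ∈ Y := ⟨le_rfl, by norm_num⟩

theorem Y_subset_Icc : Y ⊆ Icc 0 1 := Icc_subset_Icc_left (by norm_num)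

theorem mu1_absolutelyContinuous : mu1 ≪ volume :=
  (withDensity_absolutelyContinuous _ _).trans Measure.restrict_le_self.absolutelyContinuous

theorem mu1_apply {s : Set ℝ} (hs : MeasurableSet s) (hsY : s ⊆ Y) :
    mu1 s = ∫⁻ x in s, ENNReal.ofReal (density x) := by
  rw [mu1, withDensity_apply _ hs, Measure.restrict_restrict hs,
    inter_eq_left.2 (hsY.trans Y_subset_Icc)]

theorem volume_le_mu1 {s : Set ℝ} (hs : MeasurableSet s) (hsY : s ⊆ Y) : volume s ≤ mu1 s := by
  rw [mu1_apply hs hsY, ← setLIntegral_one]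
  refine setLIntegral_mono' hs fun x hx => ?_
  have h0 : 0 < x := by have := (hsY hx).1; linarith
  rw [← ENNReal.ofReal_one]
  exact ENNReal.ofReal_le_ofReal ((one_le_div h0).2 (hsY hx).2)

theorem mu1_Y_lt_top : mu1 Y < ∞ := by
  rw [mu1_apply measurableSet_Y subset_rfl]
  refine (setLIntegral_mono' (g := fun _ => 2) measurableSet_Y fun x hx => ?_).trans_lt ?_
  · have h0 : 0 < x := by have := hx.1; linarith
    have : density x ≤ 2 := by
      rw [density, div_le_iff₀ h0]; linarith [hx.1]
    exact (ENNReal.ofReal_le_ofReal this).trans (by simp)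
  · rw [setLIntegral_const]
    exact ENNReal.mul_lt_top (by simp) measure_Icc_lt_top

/-! ### Completeness, measurability and integrability of `BV(Y)` -/

namespace BVY

theorem coe_add (f g : BVY) : ((f + g : BVY) : ℝ → ℂ) = f + g := rfl

theorem coe_sub (f g : BVY) : ((f - g : BVY) : ℝ → ℂ) = f - g := rfl

theorem coe_smul (c : ℂ) (f : BVY) : ((c • f : BVY) : ℝ → ℂ) = c • (f : ℝ → ℂ) := rfl

theorem ext {f g : BVY} (h : ∀ x ∈ Y, f x = g x) : f = g := by
  refine Subtype.ext (funext fun x => ?_)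
  by_cases hx : x ∈ Y
  · exact h x hx
  · exact (f.2.1 x hx).trans (g.2.1 x hx).symm

theorem apply_of_notMem (f : BVY) {x : ℝ} (hx : x ∉ Y) : f x = 0 := f.2.1 x hx

theorem boundedVariationOn (f : BVY) : BoundedVariationOn (f : ℝ → ℂ) Y := f.2.2.2

theorem continuousWithinAt (f : BVY) {x : ℝ} (hx : x ∈ Icc (0 : ℝ) 1) :
    ContinuousWithinAt (f : ℝ → ℂ) (Icc x 1) x := f.2.2.1 x hx

/-- The supremum of `‖f‖`. -/
noncomputable def sup (f : BVY) : ℝ := ⨆ x : Icc (0 : ℝ) 1, ‖f x‖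

theorem sup_nonneg (f : BVY) : 0 ≤ f.sup := Real.iSup_nonneg fun _ => norm_nonneg _

theorem norm_apply_le_sup (f : BVY) (x : ℝ) : ‖f x‖ ≤ f.sup := by
  by_cases hx : x ∈ Y
  · exact le_ciSup f.bddAbove ⟨x, Y_subset_Icc hx⟩
  · rw [f.apply_of_notMem hx, norm_zero]; exact f.sup_nonneg

theorem sup_le (f : BVY) {a : ℝ} (ha : 0 ≤ a) (h : ∀ x ∈ Y, ‖f x‖ ≤ a) : f.sup ≤ a := by
  have : Nonempty (Icc (0 : ℝ) 1) := ⟨⟨0, by simp⟩⟩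
  refine ciSup_le fun x => ?_
  by_cases hx : (x : ℝ) ∈ Y
  · exact h x hx
  · rw [f.apply_of_notMem hx, norm_zero]; exact ha

/-- The total variation on `Y`, as a seminorm. -/
noncomputable def var : Seminorm ℂ BVY :=
  Seminorm.of (fun f => (eVariationOn (f : ℝ → ℂ) Y).toReal)
    (fun f g => by
      rw [coe_add, ← ENNReal.toReal_add f.boundedVariationOn g.boundedVariationOn]
      exact ENNReal.toReal_mono
        (ENNReal.add_ne_top.2 ⟨f.boundedVariationOn, g.boundedVariationOn⟩)
        (eVariationOn_add_le _ _ _))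
    (fun c f => by
      rw [coe_smul, eVariationOn_const_smul, ENNReal.toReal_mul, toReal_enorm])

theorem var_def (f : BVY) : var f = (eVariationOn (f : ℝ → ℂ) Y).toReal := rfl

theorem eVariationOn_eq (f : BVY) : eVariationOn (f : ℝ → ℂ) Y = ENNReal.ofReal (var f) :=
  (ENNReal.ofReal_toReal f.boundedVariationOn).symm

theorem norm_eq (f : BVY) : ‖f‖ = f.sup + var f := rfl

theorem var_le_norm (f : BVY) : var f ≤ ‖f‖ := by
  rw [norm_eq]; linarith [f.sup_nonneg]

theorem sup_le_norm (f : BVY) : f.sup ≤ ‖f‖ := by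
  rw [norm_eq]; linarith [apply_nonneg var f]

theorem norm_apply_le (f : BVY) (x : ℝ) : ‖f x‖ ≤ ‖f‖ := (f.norm_apply_le_sup x).trans f.sup_le_norm

theorem norm_apply_sub_le_var (f : BVY) {x y : ℝ} (hx : x ∈ Y) (hy : y ∈ Y) :
    ‖f x - f y‖ ≤ var f := by
  rw [← dist_eq_norm]; exact f.boundedVariationOn.dist_le hx hy

theorem var_le_of_eVariationOn_le (f : BVY) {a : ℝ} (ha : 0 ≤ a)
    (h : eVariationOn (f : ℝ → ℂ) Y ≤ ENNReal.ofReal a) : var f ≤ a :=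
  ENNReal.toReal_le_of_le_ofReal ha h

/-- Evaluation at a point. -/
noncomputable def eval (x : ℝ) : BVY →L[ℂ] ℂ :=
  LinearMap.mkContinuous
    { toFun := fun f : BVY => f x
      map_add' := fun _ _ => rfl
      map_smul' := fun _ _ => rfl } 1
    fun f => by rw [one_mul]; exact f.norm_apply_le x

theorem eval_apply (x : ℝ) (f : BVY) : eval x f = f x := rfl

instance : CompleteSpace BVY := by
  refine Metric.complete_of_cauchySeq_tendsto fun u hu => ?_
  have hpt : ∀ x, ∃ l, Tendsto (fun n => u n x) atTop (𝓝 l) := fun x =>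
    cauchySeq_tendsto_of_complete ((eval x).uniformContinuous.comp_cauchySeq hu)
  choose F hF using hpt
  have hd : ∀ ε > 0, ∃ N, ∀ n ≥ N, (∀ x, ‖u n x - F x‖ ≤ ε) ∧
      eVariationOn (fun x => u n x - F x) Y ≤ ENNReal.ofReal ε := by
    intro ε hε
    obtain ⟨N, hN⟩ := Metric.cauchySeq_iff.1 hu ε hε
    refine ⟨N, fun n hn => ⟨fun x => ?_, ?_⟩⟩
    · refine le_of_tendsto ((tendsto_const_nhds.sub (hF x)).norm) ?_
      filter_upwards [eventually_ge_atTop N] with m hm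
      have := hN n hn m hm
      rw [dist_eq_norm] at this
      exact ((u n - u m).norm_apply_le x).trans this.le
    · by_contra! hlt
      -- Variation is lower semicontinuous under pointwise convergence, so a bound on `u n - u m`
      -- survives as `m` tends to infinity.
      have h1 := eVariationOn.lowerSemicontinuous_aux (p := atTop)
        (F := fun m x => u n x - u m x) (fun x _ => tendsto_const_nhds.sub (hF x)) hlt
      obtain ⟨m, hm1, hm2⟩ := (h1.and (eventually_ge_atTop N)).exists
      have := hN n hn m hm2
      rw [dist_eq_norm] at this
      refine hm1.not_ge ?_
      change eVariationOn ((u n - u m : BVY) : ℝ → ℂ) Y ≤ _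
      rw [eVariationOn_eq]
      exact ENNReal.ofReal_le_ofReal ((var_le_norm _).trans this.le)
  have hFmem : F ∈ bvSubmodule := by
    refine ⟨fun x hx => ?_, fun x hx => ?_, ?_⟩
    · refine tendsto_nhds_unique (hF x) ?_
      simp only [fun n => (u n).apply_of_notMem hx]
      exact tendsto_const_nhds
    · refine continuousWithinAt_of_locally_uniform_approx_of_continuousWithinAt
        (left_mem_Icc.2 hx.2) fun V hV => ?_
      obtain ⟨ε, hε, hεV⟩ := Metric.mem_uniformity_dist.1 hV
      obtain ⟨N, hN⟩ := hd (ε / 2) (half_pos hε)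
      refine ⟨univ, univ_mem, u N, (u N).continuousWithinAt hx, fun y _ => hεV ?_⟩
      rw [dist_comm, dist_eq_norm]
      exact ((hN N le_rfl).1 y).trans_lt (half_lt_self hε)
    · obtain ⟨N, hN⟩ := hd 1 one_pos
      have h1 := eVariationOn_add_le (u N) ((-1 : ℂ) • fun x => u N x - F x) Y
      rw [eVariationOn_const_smul] at h1
      have h2 : (u N : ℝ → ℂ) + ((-1 : ℂ) • fun x => u N x - F x) = F := by
        ext x; simp
      rw [h2] at h1
      refine ne_top_of_le_ne_top (ENNReal.add_ne_top.2 ⟨(u N).boundedVariationOn,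
        ENNReal.mul_ne_top enorm_ne_top ?_⟩) h1
      exact ne_top_of_le_ne_top ENNReal.ofReal_ne_top (hN N le_rfl).2
  let f : BVY := (⟨F, hFmem⟩ : bvSubmodule)
  refine ⟨f, Metric.tendsto_atTop.2 fun ε hε => ?_⟩
  obtain ⟨N, hN⟩ := hd (ε / 3) (by positivity)
  refine ⟨N, fun n hn => ?_⟩
  rw [dist_eq_norm, norm_eq]
  have h1 : (u n - f).sup ≤ ε / 3 := sup_le _ (by positivity) fun x _ => (hN n hn).1 x
  have h2 : var (u n - f) ≤ ε / 3 := var_le_of_eVariationOn_le _ (by positivity) (hN n hn).2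
  linarith

/-- On `Y` bounded variation gives differentiability almost everywhere; off `Y` the function is
locally zero. Measurability is deduced from this. -/
theorem ae_continuousAt (f : BVY) : ∀ᵐ x, ContinuousAt (f : ℝ → ℂ) x := by
  have h := f.boundedVariationOn
  rw [Y, ← uIcc_of_le (by norm_num)] at h
  filter_upwards [h.ae_differentiableAt_of_mem_uIcc] with x hx
  by_cases hxY : x ∈ Y
  · rw [Y, ← uIcc_of_le (by norm_num)] at hxY
    exact (hx hxY).continuousAt
  · have : (f : ℝ → ℂ) =ᶠ[𝓝 x] fun _ => 0 := by
      filter_upwards [isClosed_Icc.isOpen_compl.mem_nhds hxY] with y hy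
      exact f.apply_of_notMem hy
    exact this.continuousAt

theorem aestronglyMeasurable (f : BVY) : AEStronglyMeasurable (f : ℝ → ℂ) volume := by
  have hS : MeasurableSet {x | ContinuousAt (f : ℝ → ℂ) x} :=
    measurableSet_of_continuousAt _
  have h1 : AEStronglyMeasurable (f : ℝ → ℂ) (volume.restrict {x | ContinuousAt (f : ℝ → ℂ) x}) :=
    ContinuousOn.aestronglyMeasurable (fun x hx => ContinuousAt.continuousWithinAt hx) hS
  have h2 : volume.restrict {x | ContinuousAt (f : ℝ → ℂ) x} = volume :=
    Measure.restrict_eq_self_of_ae_mem f.ae_continuousAt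
  exact h2 ▸ h1

theorem integrable (f : BVY) : Integrable (f : ℝ → ℂ) mu1 := by
  rw [← integrableOn_iff_integrable_of_support_subset (s := Y)
    (fun x hx => by_contra fun h => hx (f.apply_of_notMem h))]
  exact Measure.integrableOn_of_bounded (M := f.sup) mu1_Y_lt_top.ne
    (f.aestronglyMeasurable.mono_ac mu1_absolutelyContinuous)
    (ae_of_all _ fun x => f.norm_apply_le_sup x)

theorem eLpNorm_top_le (f : BVY) :
    eLpNorm (f : ℝ → ℂ) ∞ (volume.restrict (Icc (0 : ℝ) 1)) ≤ ENNReal.ofReal ‖f‖ := by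
  rw [eLpNorm_exponent_top]
  refine eLpNormEssSup_le_of_ae_bound (ae_of_all _ fun x => f.norm_apply_le x)

theorem memLp_top (f : BVY) : MemLp (f : ℝ → ℂ) ∞ (volume.restrict (Icc (0 : ℝ) 1)) :=
  ⟨f.aestronglyMeasurable.restrict, f.eLpNorm_top_le.trans_lt ENNReal.ofReal_lt_top⟩

theorem eLpNorm_one_le (f : BVY) :
    eLpNorm (f : ℝ → ℂ) 1 mu1 ≤ ENNReal.ofReal ‖f‖ * mu1 Y := by
  rw [eLpNorm_one_eq_lintegral_enorm, ← lintegral_indicator_const measurableSet_Y]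
  refine lintegral_mono fun x => ?_
  by_cases hx : x ∈ Y
  · rw [indicator_of_mem hx, ← ofReal_norm]
    exact ENNReal.ofReal_le_ofReal (f.norm_apply_le x)
  · rw [f.apply_of_notMem hx]; simp

end BVY

/-! ### Right-continuous regularization -/

/-- The projection of `ℝ` onto `Y`. -/
noncomputable def clampY (x : ℝ) : ℝ := max (1 / 2) (min x 1)

theorem clampY_mem (x : ℝ) : clampY x ∈ Y :=
  ⟨le_max_left _ _, max_le (by norm_num) (min_le_right _ _)⟩

theorem clampY_of_mem {x : ℝ} (hx : x ∈ Y) : clampY x = x := by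
  rw [clampY, min_eq_left hx.2, max_eq_right hx.1]

theorem clampY_of_one_le {x : ℝ} (hx : 1 ≤ x) : clampY x = 1 := by
  rw [clampY, min_eq_right hx]; norm_num

theorem monotone_clampY : Monotone clampY := fun _ _ h =>
  max_le_max le_rfl (min_le_min h le_rfl)

theorem eVariationOn_comp_clampY_le (G : ℝ → ℂ) :
    eVariationOn (G ∘ clampY) univ ≤ eVariationOn G Y :=
  eVariationOn.comp_le_of_monotoneOn _ _ (monotone_clampY.monotoneOn _) fun x _ => clampY_mem x

theorem boundedVariationOn_comp_clampY {G : ℝ → ℂ} (hG : BoundedVariationOn G Y) :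
    BoundedVariationOn (G ∘ clampY) univ :=
  ne_top_of_le_ne_top hG (eVariationOn_comp_clampY_le G)

/-- `F x` is the right limit of `G` at `x` for `x ∈ [1/2, 1)`, and `F 1 = G 1`. -/
def IsRightReg (G F : ℝ → ℂ) : Prop :=
  ∀ x ∈ Y, Tendsto (G ∘ clampY) (𝓝[>] x) (𝓝 (F x))

namespace IsRightReg

variable {G F G' F' : ℝ → ℂ}

theorem add (h : IsRightReg G F) (h' : IsRightReg G' F') : IsRightReg (G + G') (F + F') :=
  fun x hx => (h x hx).add (h' x hx)

theorem const_smul (c : ℂ) (h : IsRightReg G F) : IsRightReg (c • G) (c • F) :=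
  fun x hx => (h x hx).const_smul c

theorem eq_rightLim (h : IsRightReg G F) {x : ℝ} (hx : x ∈ Y) :
    F x = Function.rightLim (G ∘ clampY) x :=
  (rightLim_eq_of_tendsto (h x hx)).symm

theorem apply_one (h : IsRightReg G F) : F 1 = G 1 := by
  refine tendsto_nhds_unique (h 1 one_mem_Y) (tendsto_const_nhds.congr' ?_)
  filter_upwards [self_mem_nhdsWithin] with y hy
  rw [Function.comp_apply, clampY_of_one_le (le_of_lt hy)]

theorem eVariationOn_le (h : IsRightReg G F) : eVariationOn F Y ≤ eVariationOn G Y := by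
  rw [eVariationOn.congr fun x hx => h.eq_rightLim hx]
  exact (eVariationOn.mono _ (subset_univ _)).trans
    ((eVariationOn.eVariationOn_rightLim_le isOpen_univ).trans (eVariationOn_comp_clampY_le G))

theorem norm_sub_le (h : IsRightReg G F) {c : ℂ} {a : ℝ} (ha : ∀ x ∈ Y, ‖G x - c‖ ≤ a) {x : ℝ}
    (hx : x ∈ Y) : ‖F x - c‖ ≤ a :=
  le_of_tendsto ((h x hx).sub tendsto_const_nhds).norm
    (Eventually.of_forall fun y => ha _ (clampY_mem y))

theorem norm_le (h : IsRightReg G F) {a : ℝ} (ha : ∀ x ∈ Y, ‖G x‖ ≤ a) {x : ℝ}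
    (hx : x ∈ Y) : ‖F x‖ ≤ a := by
  simpa using h.norm_sub_le (c := 0) (by simpa using ha) hx

theorem unique {f g : BVY} (hf : IsRightReg G f) (hg : IsRightReg G g) : f = g :=
  BVY.ext fun x hx => tendsto_nhds_unique (hf x hx) (hg x hx)

theorem ae_eq (h : IsRightReg G F) (hG : BoundedVariationOn G Y) : ∀ᵐ x, x ∈ Y → F x = G x := by
  filter_upwards [((boundedVariationOn_comp_clampY hG).locallyBoundedVariationOn).ae_differentiableAt]
    with x hx hxY
  rw [h.eq_rightLim hxY, hx.continuousAt.continuousWithinAt.rightLim_eq, Function.comp_apply,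
    clampY_of_mem hxY]

/-- Passing to right limits does not change left limits, so continuity of `G` at `1` from the left
is inherited. -/
theorem tendsto_left_one (h : IsRightReg G F) (hG : BoundedVariationOn G Y)
    (h1 : Tendsto G (𝓝[<] 1) (𝓝 (G 1))) : Tendsto F (𝓝[<] 1) (𝓝 (F 1)) := by
  have hb := boundedVariationOn_comp_clampY hG
  have hev : ∀ᶠ x in 𝓝[<] (1 : ℝ), x ∈ Y := by
    filter_upwards [Ioo_mem_nhdsLT (show (1 / 2 : ℝ) < 1 by norm_num)] with x hx
    exact ⟨hx.1.le, hx.2.le⟩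
  have h2 : Tendsto (G ∘ clampY) (𝓝[<] 1) (𝓝 (G 1)) :=
    h1.congr' (hev.mono fun x hx => by rw [Function.comp_apply, clampY_of_mem hx])
  have h3 := hb.rightLim.tendsto_leftLim 1
  rw [leftLim_rightLim (hb.tendsto_leftLim 1), leftLim_eq_of_tendsto h2,
    ← h.apply_one] at h3
  exact h3.congr' (hev.mono fun x hx => (h.eq_rightLim hx).symm)

end IsRightReg

theorem exists_isRightReg {G : ℝ → ℂ} (hG : BoundedVariationOn G Y) :
    ∃ f : BVY, IsRightReg G f := by
  have hb := boundedVariationOn_comp_clampY hG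
  set F : ℝ → ℂ := Y.indicator (Function.rightLim (G ∘ clampY)) with hF
  have hreg : IsRightReg G F := fun x hx => by
    rw [hF, indicator_of_mem hx]
    exact hb.tendsto_rightLim x
  have hmem : F ∈ bvSubmodule := by
    refine ⟨fun x hx => indicator_of_notMem hx _, fun x hx => ?_,
      ne_top_of_le_ne_top hG hreg.eVariationOn_le⟩
    by_cases hxY : x ∈ Y
    · refine ((hb.continuousWithinAt_rightLim (x := x)).mono Icc_subset_Ici_self).congr
        (fun y hy => ?_) ?_
      · have hyY : y ∈ Y := ⟨hxY.1.trans hy.1, hy.2⟩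
        rw [hF, indicator_of_mem hyY]
      · rw [hF, indicator_of_mem hxY]
    · have h0 : F =ᶠ[𝓝 x] fun _ => 0 := by
        filter_upwards [isClosed_Icc.isOpen_compl.mem_nhds hxY] with y hy
        exact indicator_of_notMem hy _
      exact h0.continuousAt.continuousWithinAt
  exact ⟨(⟨F, hmem⟩ : bvSubmodule), hreg⟩

/-! ### The full branches of the induced map and their weights -/

/-- The inverse branch of the induced map with return time `k + 1`. -/
noncomputable def branch (k : ℕ) (x : ℝ) : ℝ := (1 + k * x) / (1 + (k + 1) * x)

/-- The weight of the inverse branch with return time `k + 1`. -/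
noncomputable def weight (k : ℕ) (x : ℝ) : ℝ := x / ((1 + k * x) * (1 + (k + 1) * x))

/-- The left endpoint of the range of `branch k`. -/
noncomputable def cut (k : ℕ) : ℝ := (k + 1) / (k + 2)

/-- The length of the range of `branch k`. -/
noncomputable def cellLength (k : ℕ) : ℝ := 1 / ((k + 2) * (k + 3))

theorem cellLength_pos (k : ℕ) : 0 < cellLength k := by unfold cellLength; positivity

theorem cut_succ_sub (k : ℕ) : cut (k + 1) - cut k = cellLength k := by
  unfold cut cellLength; push_cast; field_simp; ring

theorem monotone_cut : Monotone cut :=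
  monotone_nat_of_le_succ fun k => by linarith [cut_succ_sub k, cellLength_pos k]

theorem cut_zero : cut 0 = 1 / 2 := by norm_num [cut]

theorem cut_lt_one (k : ℕ) : cut k < 1 := by
  unfold cut; rw [div_lt_one (by positivity)]; linarith

theorem cut_mem_Y (k : ℕ) : cut k ∈ Y :=
  ⟨cut_zero ▸ monotone_cut (Nat.zero_le k), (cut_lt_one k).le⟩

theorem pos_of_mem_Y {x : ℝ} (hx : x ∈ Y) : 0 < x := by have := hx.1; linarith

theorem branch_one (k : ℕ) : branch k 1 = cut k := by
  unfold branch cut; congr 1 <;> ring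

theorem branch_half (k : ℕ) : branch k (1 / 2) = cut (k + 1) := by
  unfold branch cut; push_cast; field_simp; ring

theorem branch_sub (k : ℕ) {x y : ℝ} (hx : 0 < x) (hy : 0 < y) :
    branch k x - branch k y = (y - x) / ((1 + (k + 1) * x) * (1 + (k + 1) * y)) := by
  unfold branch; field_simp; ring

theorem antitoneOn_branch (k : ℕ) : AntitoneOn (branch k) (Ioi 0) := fun x hx y hy hxy => by
  have h := branch_sub k hx hy
  have : 0 ≤ (y - x) / ((1 + (k + 1) * x) * (1 + (k + 1) * y)) := by
    have : (0 : ℝ) < x := hx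
    have : (0 : ℝ) < y := hy
    exact div_nonneg (by linarith) (by positivity)
  linarith

theorem strictAntiOn_branch (k : ℕ) : StrictAntiOn (branch k) (Ioi 0) := fun x hx y hy hxy => by
  have h := branch_sub k hx hy
  have : 0 < (y - x) / ((1 + (k + 1) * x) * (1 + (k + 1) * y)) := by
    have : (0 : ℝ) < x := hx
    have : (0 : ℝ) < y := hy
    exact div_pos (by linarith) (by positivity)
  linarith

theorem branch_mem_cell (k : ℕ) {x : ℝ} (hx : x ∈ Y) : branch k x ∈ Icc (cut k) (cut (k + 1)) := by
  rw [← branch_one, ← branch_half]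
  have h := pos_of_mem_Y hx
  exact ⟨antitoneOn_branch k h (mem_Ioi.2 one_pos) hx.2,
    antitoneOn_branch k (mem_Ioi.2 (by norm_num)) h hx.1⟩

theorem cell_subset_Y (k : ℕ) : Icc (cut k) (cut (k + 1)) ⊆ Y := fun _ hx =>
  ⟨(cut_mem_Y k).1.trans hx.1, hx.2.trans (cut_mem_Y _).2⟩

theorem branch_mem_Y (k : ℕ) {x : ℝ} (hx : x ∈ Y) : branch k x ∈ Y :=
  cell_subset_Y k (branch_mem_cell k hx)

theorem branch_le_branch (k : ℕ) {x y : ℝ} (hx : x ∈ Y) (hy : y ∈ Y) :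
    branch k x ≤ branch (k + 1) y :=
  (branch_mem_cell k hx).2.trans (branch_mem_cell (k + 1) hy).1

/-- This telescoping form makes the weights a probability vector with explicit tails. -/
theorem weight_eq_sub (k : ℕ) {x : ℝ} (hx : 0 < x) :
    weight k x = 1 / (1 + k * x) - 1 / (1 + (k + 1) * x) := by
  unfold weight; field_simp; ring

theorem weight_pos (k : ℕ) {x : ℝ} (hx : 0 < x) : 0 < weight k x := by
  unfold weight; positivity

theorem weight_succ_le (k : ℕ) {x : ℝ} (hx : 0 < x) : weight (k + 1) x ≤ weight k x := by
  unfold weight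
  push_cast
  rw [mul_comm (1 + (k : ℝ) * x)]
  gcongr
  linarith

theorem weight_le_half (k : ℕ) {x : ℝ} (hx : x ∈ Y) : weight k x ≤ 1 / 2 := by
  have h0 := pos_of_mem_Y hx
  unfold weight
  rw [div_le_div_iff₀ (by positivity) (by norm_num)]
  have h1 : 0 ≤ (k : ℝ) * x := by positivity
  nlinarith [hx.2]

theorem weight_le_cellLength (k : ℕ) {x : ℝ} (hx : x ∈ Y) : weight k x ≤ 4 * cellLength k := by
  have h0 := pos_of_mem_Y hx
  have h1 : ((k : ℝ) + 2) / 2 ≤ 1 + k * x := by nlinarith [hx.1, k.cast_nonneg (α := ℝ)]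
  have h2 : ((k : ℝ) + 3) / 2 ≤ 1 + (k + 1) * x := by nlinarith [hx.1, k.cast_nonneg (α := ℝ)]
  calc weight k x ≤ 1 / ((((k : ℝ) + 2) / 2) * (((k : ℝ) + 3) / 2)) := by
        unfold weight
        gcongr
        exact hx.2
    _ = 4 * cellLength k := by unfold cellLength; field_simp; ring

theorem half_le_weight (k : ℕ) {x : ℝ} (hx : x ∈ Y) :
    1 / (2 * ((k + 1) * (k + 2))) ≤ weight k x := by
  have h0 := pos_of_mem_Y hx
  have hk : (0 : ℝ) ≤ k := k.cast_nonneg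
  have h1 : 1 + k * x ≤ k + 1 := by nlinarith [hx.2]
  have h2 : 1 + (k + 1) * x ≤ k + 2 := by nlinarith [hx.2]
  calc (1 : ℝ) / (2 * ((k + 1) * (k + 2))) = (1 / 2) / ((k + 1) * (k + 2)) := by field_simp
    _ ≤ weight k x := by
        unfold weight
        gcongr
        exact hx.1

/-- In the exact difference quotient the numerator is at most `(k+2)(k+3)` and each of the two
denominators is at least a quarter of that. -/
theorem abs_weight_sub_le (k : ℕ) {x y : ℝ} (hx : x ∈ Y) (hy : y ∈ Y) :
    |weight k x - weight k y| ≤ 16 * cellLength k * |x - y| := by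
  have hx0 := pos_of_mem_Y hx
  have hy0 := pos_of_mem_Y hy
  have hk : (0 : ℝ) ≤ k := k.cast_nonneg
  have h1 : weight k x - weight k y = (x - y) * ((1 - k * (k + 1) * (x * y)) /
      ((1 + k * x) * (1 + (k + 1) * x) * ((1 + k * y) * (1 + (k + 1) * y)))) := by
    unfold weight; field_simp; ring
  have hD : ∀ {t : ℝ}, t ∈ Y → (k + 2) * (k + 3) / 4 ≤ (1 + k * t) * (1 + (k + 1) * t) := by
    intro t ht
    have h1 : ((k : ℝ) + 2) / 2 ≤ 1 + k * t := by nlinarith [ht.1]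
    have h2 : ((k : ℝ) + 3) / 2 ≤ 1 + (k + 1) * t := by nlinarith [ht.1]
    have h3 := mul_le_mul h1 h2 (by positivity) (by have := pos_of_mem_Y ht; positivity)
    linarith
  have hxy : x * y ≤ 1 := mul_le_one₀ hx.2 hy0.le hy.2
  have hnum : |1 - k * (k + 1) * (x * y)| ≤ (k + 2) * (k + 3) := by
    have h3 : 0 ≤ (k : ℝ) * (k + 1) * (x * y) := by positivity
    have h4 : (k : ℝ) * (k + 1) * (x * y) ≤ k * (k + 1) :=
      mul_le_of_le_one_right (by positivity) hxy
    rw [abs_le]; constructor <;> nlinarith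
  rw [h1, abs_mul, mul_comm, abs_div]
  gcongr
  rw [abs_of_pos (a := (1 + k * x) * (1 + (k + 1) * x) * ((1 + k * y) * (1 + (k + 1) * y)))
    (by positivity)]
  calc _ ≤ ((k : ℝ) + 2) * (k + 3) / (((k + 2) * (k + 3) / 4) * ((k + 2) * (k + 3) / 4)) := by
        gcongr
        · exact hD hx
        · exact hD hy
    _ = 16 * cellLength k := by unfold cellLength; field_simp; ring

theorem sum_weight (N : ℕ) {x : ℝ} (hx : 0 < x) :
    ∑ k ∈ Finset.range N, weight k x = 1 - 1 / (1 + N * x) := by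
  induction N with
  | zero => simp
  | succ N ih => rw [Finset.sum_range_succ, ih, weight_eq_sub N hx]; push_cast; ring

theorem tendsto_inv_one_add_mul {x : ℝ} (hx : 0 < x) :
    Tendsto (fun N : ℕ => 1 / (1 + N * x)) atTop (𝓝 0) := by
  simp only [one_div]
  exact tendsto_inv_atTop_zero.comp
    (tendsto_atTop_add_const_left _ _ (tendsto_natCast_atTop_atTop.atTop_mul_const hx))

theorem hasSum_weight {x : ℝ} (hx : 0 < x) : HasSum (fun k => weight k x) 1 := by
  rw [hasSum_iff_tendsto_nat_of_nonneg fun k => (weight_pos k hx).le]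
  simp only [sum_weight _ hx]
  simpa using (tendsto_inv_one_add_mul hx).const_sub 1

theorem hasSum_cellLength : HasSum cellLength (1 / 2) := by
  have h : cellLength = fun k => 1 / 2 * weight k (1 / 2) := by
    funext k; unfold cellLength weight; field_simp; ring
  rw [h]
  have := (hasSum_weight (show (0 : ℝ) < 1 / 2 by norm_num)).mul_left (1 / 2)
  simpa using this

/-! ### The operators attached to the branches -/

/-- The weighted composition with `branch k`, before regularization. -/
noncomputable def preOp (k : ℕ) (f : ℝ → ℂ) (x : ℝ) : ℂ := weight k x • f (branch k x)

theorem norm_preOp_le (k : ℕ) (f : BVY) {x : ℝ} (hx : x ∈ Y) :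
    ‖preOp k f x‖ ≤ weight k x * f.sup := by
  have h0 := weight_pos k (pos_of_mem_Y hx)
  rw [preOp, norm_smul, Real.norm_of_nonneg h0.le]
  exact mul_le_mul_of_nonneg_left (f.norm_apply_le_sup _) h0.le

theorem norm_preOp_le' (k : ℕ) (f : BVY) {x : ℝ} (hx : x ∈ Y) :
    ‖preOp k f x‖ ≤ 4 * cellLength k * f.sup :=
  (norm_preOp_le k f hx).trans
    (mul_le_mul_of_nonneg_right (weight_le_cellLength k hx) f.sup_nonneg)

theorem eVariationOn_weight_le (k : ℕ) :
    eVariationOn (weight k) Y ≤ ENNReal.ofReal (8 * cellLength k) := by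
  have hlip : LipschitzOnWith (Real.toNNReal (16 * cellLength k)) (weight k) Y :=
    LipschitzOnWith.of_dist_le_mul fun x hx y hy => by
      rw [Real.coe_toNNReal _ (by have := cellLength_pos k; positivity)]
      exact abs_weight_sub_le k hx hy
  have h := hlip.comp_eVariationOn_le (s := Y) (g := id) (fun x hx => hx)
  rw [Function.comp_id] at h
  refine h.trans ?_
  rw [Y, eVariationOn_id_Icc]
  change ENNReal.ofReal _ * _ ≤ _
  rw [← ENNReal.ofReal_mul (by have := cellLength_pos k; positivity)]
  exact ENNReal.ofReal_le_ofReal (by linarith)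

/-- Product rule for the variation. Only the variation of `f` on a single cell enters, so the bounds
can be summed over `k` without loss. -/
theorem eVariationOn_preOp_le (k : ℕ) (f : BVY) {M : ℝ} (hM : ∀ x ∈ Y, weight k x ≤ M) :
    eVariationOn (preOp k f) Y ≤
      ENNReal.ofReal M * eVariationOn (f : ℝ → ℂ) (Icc (cut k) (cut (k + 1))) +
        ENNReal.ofReal (8 * cellLength k * f.sup) := by
  have h1 := eVariationOn_smul_le (f := weight k) (g := (f : ℝ → ℂ) ∘ branch k) (s := Y)
    (C := ENNReal.ofReal M) (D := ENNReal.ofReal f.sup)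
    (fun x hx => by
      rw [← ofReal_norm, Real.norm_of_nonneg (weight_pos k (pos_of_mem_Y hx)).le]
      exact ENNReal.ofReal_le_ofReal (hM x hx))
    (fun x _ => by
      rw [← ofReal_norm]
      exact ENNReal.ofReal_le_ofReal (f.norm_apply_le_sup _))
  refine h1.trans (add_le_add ?_ ?_)
  · gcongr
    exact eVariationOn.comp_le_of_antitoneOn _ _
      ((antitoneOn_branch k).mono fun x hx => pos_of_mem_Y hx) fun x hx => branch_mem_cell k hx
  · rw [mul_comm (8 * cellLength k), ENNReal.ofReal_mul f.sup_nonneg]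
    gcongr
    exact eVariationOn_weight_le k

/-- The variation of `f` on the range of `branch k`. -/
noncomputable def cellVar (k : ℕ) (f : BVY) : ℝ :=
  (eVariationOn (f : ℝ → ℂ) (Icc (cut k) (cut (k + 1)))).toReal

theorem eVariationOn_cell_le (k : ℕ) (f : BVY) :
    eVariationOn (f : ℝ → ℂ) (Icc (cut k) (cut (k + 1))) ≤ eVariationOn (f : ℝ → ℂ) Y :=
  eVariationOn.mono _ (cell_subset_Y k)

theorem eVariationOn_cell_ne_top (k : ℕ) (f : BVY) :
    eVariationOn (f : ℝ → ℂ) (Icc (cut k) (cut (k + 1))) ≠ ∞ :=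
  ne_top_of_le_ne_top f.boundedVariationOn (eVariationOn_cell_le k f)

theorem cellVar_le (k : ℕ) (f : BVY) : cellVar k f ≤ BVY.var f :=
  ENNReal.toReal_mono f.boundedVariationOn (eVariationOn_cell_le k f)

theorem cellVar_nonneg (k : ℕ) (f : BVY) : 0 ≤ cellVar k f := ENNReal.toReal_nonneg

theorem sum_cellVar_le (N : ℕ) (f : BVY) : ∑ k ∈ Finset.range N, cellVar k f ≤ BVY.var f := by
  unfold cellVar
  rw [← ENNReal.toReal_sum fun k _ => eVariationOn_cell_ne_top k f,
    eVariationOn.sum' _ monotone_cut]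
  exact ENNReal.toReal_mono f.boundedVariationOn
    (eVariationOn.mono _ (Icc_subset_Icc (cut_mem_Y 0).1 (cut_mem_Y N).2))

theorem eVariationOn_preOp_le_ofReal (k : ℕ) (f : BVY) {M : ℝ} (hM : ∀ x ∈ Y, weight k x ≤ M) :
    eVariationOn (preOp k f) Y ≤ ENNReal.ofReal (M * cellVar k f + 8 * cellLength k * f.sup) := by
  have hM0 : 0 ≤ M := (weight_pos k one_pos).le.trans (hM 1 one_mem_Y)
  rw [ENNReal.ofReal_add (mul_nonneg hM0 (cellVar_nonneg k f))
    (mul_nonneg (by have := cellLength_pos k; positivity) f.sup_nonneg), ENNReal.ofReal_mul hM0,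
    cellVar, ENNReal.ofReal_toReal (eVariationOn_cell_ne_top k f)]
  exact eVariationOn_preOp_le k f hM

theorem boundedVariationOn_preOp (k : ℕ) (f : BVY) : BoundedVariationOn (preOp k f) Y :=
  ne_top_of_le_ne_top ENNReal.ofReal_ne_top
    (eVariationOn_preOp_le_ofReal k f fun _ hx => weight_le_half k hx)

/-- The linear map underlying `branchOp`. -/
noncomputable def branchLinearMap (k : ℕ) : BVY →ₗ[ℂ] BVY where
  toFun f := (exists_isRightReg (boundedVariationOn_preOp k f)).choose
  map_add' f g := by
    refine IsRightReg.unique (exists_isRightReg (boundedVariationOn_preOp k (f + g))).choose_spec ?_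
    convert (exists_isRightReg (boundedVariationOn_preOp k f)).choose_spec.add
      (exists_isRightReg (boundedVariationOn_preOp k g)).choose_spec using 1
    · ext x
      simp [preOp, BVY.coe_add]
    · rfl
  map_smul' c f := by
    refine IsRightReg.unique (exists_isRightReg (boundedVariationOn_preOp k (c • f))).choose_spec ?_
    convert (exists_isRightReg (boundedVariationOn_preOp k f)).choose_spec.const_smul c using 1
    · ext x
      simp [preOp, BVY.coe_smul]
      ring
    · rfl

theorem isRightReg_branchLinearMap (k : ℕ) (f : BVY) :
    IsRightReg (preOp k f) (branchLinearMap k f) :=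
  (exists_isRightReg (boundedVariationOn_preOp k f)).choose_spec

theorem var_branchLinearMap_le (k : ℕ) (f : BVY) {M : ℝ} (hM : ∀ x ∈ Y, weight k x ≤ M) :
    BVY.var (branchLinearMap k f) ≤ M * cellVar k f + 8 * cellLength k * f.sup := by
  have hM0 : 0 ≤ M := (weight_pos k one_pos).le.trans (hM 1 one_mem_Y)
  have h1 := cellVar_nonneg k f
  have h2 := cellLength_pos k
  have h3 := f.sup_nonneg
  exact BVY.var_le_of_eVariationOn_le _ (by positivity)
    ((isRightReg_branchLinearMap k f).eVariationOn_le.trans (eVariationOn_preOp_le_ofReal k f hM))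

/-- The constant is `4 + 8`: the size of the weight plus its variation. -/
theorem norm_branchLinearMap_le (k : ℕ) (f : BVY) :
    ‖branchLinearMap k f‖ ≤ 12 * cellLength k * ‖f‖ := by
  have h0 := cellLength_pos k
  have h1 : (branchLinearMap k f).sup ≤ 4 * cellLength k * f.sup :=
    BVY.sup_le _ (mul_nonneg (by positivity) f.sup_nonneg)
      fun x hx => (isRightReg_branchLinearMap k f).norm_le (fun y hy => norm_preOp_le' k f hy) hx
  have h2 := var_branchLinearMap_le k f fun x hx => weight_le_cellLength k hx
  have h3 : 4 * cellLength k * cellVar k f ≤ 4 * cellLength k * BVY.var f :=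
    mul_le_mul_of_nonneg_left (cellVar_le k f) (by positivity)
  have h4 : 0 ≤ cellLength k * BVY.var f := mul_nonneg h0.le (apply_nonneg _ _)
  rw [BVY.norm_eq, BVY.norm_eq]
  linarith

/-- The first return operator with return time `k + 1`, on `BV(Y)`. -/
noncomputable def branchOp (k : ℕ) : BVY →L[ℂ] BVY :=
  (branchLinearMap k).mkContinuous (12 * cellLength k) (norm_branchLinearMap_le k)

theorem norm_branchOp_le (k : ℕ) : ‖branchOp k‖ ≤ 12 * cellLength k :=
  LinearMap.mkContinuous_norm_le _ (by have := cellLength_pos k; positivity) _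

theorem isRightReg_branchOp (k : ℕ) (f : BVY) : IsRightReg (preOp k f) (branchOp k f) :=
  isRightReg_branchLinearMap k f

/-- As `x` increases to `1`, `branch k x` decreases to `cut k`, where `f` is right-continuous. -/
theorem tendsto_preOp_left_one (k : ℕ) (f : BVY) :
    Tendsto (preOp k f) (𝓝[<] 1) (𝓝 (preOp k f 1)) := by
  have hw : ContinuousAt (weight k) 1 := by
    unfold weight
    exact ContinuousAt.div (by fun_prop) (by fun_prop) (by positivity)
  have hb : ContinuousAt (branch k) 1 := by
    unfold branch
    exact ContinuousAt.div (by fun_prop) (by fun_prop) (by positivity)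
  refine (hw.tendsto.mono_left nhdsWithin_le_nhds).smul ?_
  rw [branch_one]
  have hf := f.continuousWithinAt (Y_subset_Icc (cut_mem_Y k))
  refine hf.tendsto.comp (tendsto_nhdsWithin_iff.2 ⟨?_, ?_⟩)
  · have := hb.tendsto.mono_left (nhdsWithin_le_nhds (s := Iio 1))
    rwa [branch_one] at this
  · filter_upwards [Ioo_mem_nhdsLT (show (1 / 2 : ℝ) < 1 by norm_num)] with x hx
    have hxY : x ∈ Y := ⟨hx.1.le, hx.2.le⟩
    exact ⟨(branch_mem_cell k hxY).1, (branch_mem_Y k hxY).2⟩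

/-! ### The generating series -/

/-- The family of first return operators. -/
noncomputable def returnOp (n : ℕ+) : BVY →L[ℂ] BVY := branchOp n.natPred

theorem norm_pow_succ_le_one {z : ℂ} (hz : ‖z‖ ≤ 1) (k : ℕ) : ‖z ^ (k + 1)‖ ≤ 1 := by
  rw [norm_pow]; exact pow_le_one₀ (norm_nonneg z) hz

theorem summable_branchOp {z : ℂ} (hz : ‖z‖ ≤ 1) :
    Summable fun k : ℕ => z ^ (k + 1) • branchOp k := by
  refine Summable.of_norm_bounded (hasSum_cellLength.summable.mul_left 12) fun k => ?_
  rw [norm_smul]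
  exact (mul_le_of_le_one_left (norm_nonneg _) (norm_pow_succ_le_one hz k)).trans
    (norm_branchOp_le k)

theorem returnOp_comp_symm (z : ℂ) :
    (fun n : ℕ+ => z ^ (n : ℕ) • returnOp n) ∘ Equiv.pnatEquivNat.symm =
      fun k : ℕ => z ^ (k + 1) • branchOp k := by
  funext k
  simp [returnOp]

theorem summable_returnOp {z : ℂ} (hz : ‖z‖ ≤ 1) :
    Summable fun n : ℕ+ => z ^ (n : ℕ) • returnOp n := by
  rw [← Equiv.pnatEquivNat.symm.summable_iff, returnOp_comp_symm]
  exact summable_branchOp hz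

theorem hasSum_genOp {z : ℂ} (hz : ‖z‖ ≤ 1) :
    HasSum (fun k : ℕ => z ^ (k + 1) • branchOp k) (genOp returnOp z) := by
  rw [← returnOp_comp_symm, Equiv.pnatEquivNat.symm.hasSum_iff]
  exact (summable_returnOp hz).hasSum

/-- The pointwise generating series before regularization. -/
noncomputable def preGen (z : ℂ) (f : ℝ → ℂ) (x : ℝ) : ℂ := ∑' k : ℕ, z ^ (k + 1) * preOp k f x

theorem norm_preGen_term_le {z : ℂ} (hz : ‖z‖ ≤ 1) (f : BVY) {x : ℝ} (hx : x ∈ Y) (k : ℕ) :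
    ‖z ^ (k + 1) * preOp k f x‖ ≤ 4 * cellLength k * f.sup := by
  rw [norm_mul]
  exact (mul_le_of_le_one_left (norm_nonneg _) (norm_pow_succ_le_one hz k)).trans
    (norm_preOp_le' k f hx)

theorem summable_bound (f : BVY) : Summable fun k => 4 * cellLength k * f.sup :=
  (hasSum_cellLength.summable.mul_left 4).mul_right _

theorem hasSum_preGen {z : ℂ} (hz : ‖z‖ ≤ 1) (f : BVY) {x : ℝ} (hx : x ∈ Y) :
    HasSum (fun k => z ^ (k + 1) * preOp k f x) (preGen z f x) :=
  (Summable.of_norm_bounded (summable_bound f) (norm_preGen_term_le hz f hx)).hasSum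

theorem hasSum_genOp_apply {z : ℂ} (hz : ‖z‖ ≤ 1) (f : BVY) (x : ℝ) :
    HasSum (fun k => z ^ (k + 1) * branchOp k f x) (genOp returnOp z f x) := by
  have h := (hasSum_genOp hz).mapL (ContinuousLinearMap.apply ℂ BVY f)
  exact h.mapL (BVY.eval x)

/-- Right limits commute with the series by dominated convergence. Estimates can therefore be proved
for `preGen`, which is explicit, and then transferred. -/
theorem isRightReg_genOp {z : ℂ} (hz : ‖z‖ ≤ 1) (f : BVY) :
    IsRightReg (preGen z f) (genOp returnOp z f) := fun x hx => by
  rw [← (hasSum_genOp_apply hz f x).tsum_eq]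
  refine tendsto_tsum_of_dominated_convergence (summable_bound f) (fun k => ?_)
    (Eventually.of_forall fun y k => norm_preGen_term_le hz f (clampY_mem y) k)
  exact ((isRightReg_branchOp k f) x hx).const_mul _

/-! ### The first return time -/

theorem returnTime_eq {y : ℝ} {n : ℕ} (hn : 1 ≤ n) (h : fareyMap^[n] y ∈ Y)
    (h' : ∀ m, 1 ≤ m → m < n → fareyMap^[m] y ∉ Y) : returnTime y = n := by
  refine le_antisymm (sInf_le ⟨n, ⟨hn, h⟩, rfl⟩) (le_sInf ?_)
  rintro _ ⟨m, ⟨hm, hmY⟩, rfl⟩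
  refine Nat.cast_le.2 (not_lt.1 fun hlt => h' m hm hlt hmY)

/-- The left branch of the map lowers `1 / t` by one. -/
theorem fareyMap_iterate_of_mul_le {t : ℝ} (ht : 0 < t) (j : ℕ) (hj : (j + 1) * t ≤ 1) :
    fareyMap^[j] t = t / (1 - j * t) := by
  induction j with
  | zero => simp
  | succ j ih =>
    push_cast at hj
    have h1 : 0 < 1 - j * t := by linarith
    have h2 : 0 < 1 - (j + 1) * t := by linarith
    have h3 : t / (1 - j * t) ≤ 1 / 2 := by rw [div_le_div_iff₀ h1 two_pos]; linarith
    rw [Function.iterate_succ_apply', ih (by linarith), fareyMap, if_pos h3]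
    push_cast
    have h4 : 1 - t / (1 - j * t) = (1 - (j + 1) * t) / (1 - j * t) := by
      rw [eq_div_iff h1.ne', sub_mul, div_mul_cancel₀ _ h1.ne']; ring
    rw [h4, div_div_div_cancel_right₀ h1.ne']

/-- The image `t` of `y` satisfies `1/(k+2) ≤ t < 1/(k+1)`, and each further step lowers `1 / t` by
one until it is at most `2`. -/
theorem returnTime_of_mem_Ioc {k : ℕ} {y : ℝ} (hy : y ∈ Ioc (cut k) (cut (k + 1))) :
    returnTime y = (k + 1 : ℕ) := by
  have hy1 : 1 / 2 < y := (cut_mem_Y k).1.trans_lt hy.1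
  have hy0 : 0 < y := by linarith
  have hylt : y < 1 := hy.2.trans_lt (cut_lt_one _)
  have hT : fareyMap y = (1 - y) / y := if_neg hy1.not_ge
  set t := (1 - y) / y with ht
  have ht0 : 0 < t := div_pos (by linarith) hy0
  have hlow : 1 ≤ (k + 2) * t := by
    have h := hy.2
    rw [cut] at h
    push_cast at h
    rw [le_div_iff₀ (by positivity)] at h
    rw [ht, ← mul_div_assoc, one_le_div hy0]
    linarith
  have hup : (k + 1) * t ≤ 1 := by
    have h := hy.1.le
    rw [cut, div_le_iff₀ (by positivity)] at h
    rw [ht, ← mul_div_assoc, div_le_one hy0]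
    linarith
  have hup' : (k + 1) * t < 1 := by
    have h := hy.1
    rw [cut, div_lt_iff₀ (by positivity)] at h
    rw [ht, ← mul_div_assoc, div_lt_one hy0]
    linarith
  refine returnTime_eq (by omega) ?_ fun m hm hmk => ?_
  · rw [Function.iterate_succ_apply, hT, fareyMap_iterate_of_mul_le ht0 k hup]
    have h1 : 0 < 1 - k * t := by linarith
    constructor
    · rw [div_le_div_iff₀ two_pos h1]; linarith
    · rw [div_le_one h1]; linarith
  · obtain ⟨j, rfl⟩ : ∃ j, m = j + 1 := ⟨m - 1, by omega⟩
    have hjk : (j : ℝ) + 1 ≤ k := by exact_mod_cast (show j + 1 ≤ k by omega)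
    have hjt : ((j : ℝ) + 2) * t ≤ (k + 1) * t :=
      mul_le_mul_of_nonneg_right (by linarith) ht0.le
    rw [Function.iterate_succ_apply, hT, fareyMap_iterate_of_mul_le ht0 j (by linarith)]
    have h1 : 0 < 1 - j * t := by linarith
    intro h
    have h2 := h.1
    rw [div_le_div_iff₀ two_pos h1] at h2
    linarith

theorem Ioc_subset_levelSet (k : ℕ) : Ioc (cut k) (cut (k + 1)) ⊆ levelSet (k + 1) := fun _ hy =>
  ⟨cell_subset_Y k (Ioc_subset_Icc_self hy), returnTime_of_mem_Ioc hy⟩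

theorem returnTime_one : returnTime 1 = ⊤ := by
  have h0 : ∀ n : ℕ, fareyMap^[n] 0 = 0 := fun n =>
    Function.iterate_fixed (by norm_num [fareyMap]) n
  have h : {n : ℕ | 1 ≤ n ∧ fareyMap^[n] 1 ∈ Y} = ∅ := by
    refine eq_empty_of_forall_notMem ?_
    rintro n ⟨hn, hnY⟩
    obtain ⟨j, rfl⟩ : ∃ j, n = j + 1 := ⟨n - 1, by omega⟩
    have h1 : fareyMap 1 = 0 := by norm_num [fareyMap]
    rw [Function.iterate_succ_apply, h1, h0] at hnY
    have := hnY.1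
    norm_num at this
  rw [returnTime, h, image_empty, sInf_empty]

theorem returnTime_half : returnTime (1 / 2) = (1 : ℕ) := by
  refine returnTime_eq le_rfl ?_ fun m hm hm' => by omega
  have h : fareyMap (1 / 2) = 1 := by norm_num [fareyMap]
  rw [Function.iterate_one, h]
  exact one_mem_Y

theorem exists_mem_Ioc_cut {y : ℝ} (hy : 1 / 2 < y) (hy' : y < 1) :
    ∃ k, y ∈ Ioc (cut k) (cut (k + 1)) := by
  classical
  have hex : ∃ k, y ≤ cut k := by
    obtain ⟨N, hN⟩ := exists_nat_gt (1 / (1 - y))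
    refine ⟨N, ?_⟩
    have h1 : 0 < 1 - y := by linarith
    rw [div_lt_iff₀ h1] at hN
    rw [cut, le_div_iff₀ (by positivity)]
    linarith
  have h0 : Nat.find hex ≠ 0 := fun h => by
    have := Nat.find_spec hex
    rw [h, cut_zero] at this
    linarith
  obtain ⟨k, hk⟩ := Nat.exists_eq_succ_of_ne_zero h0
  refine ⟨k, not_le.1 (Nat.find_min hex (by omega)), ?_⟩
  have := Nat.find_spec hex
  rwa [hk] at this

/-- The half-open cells miss only the endpoints of `Y`: `1/2` returns at once, `1` never. -/
theorem levelSet_subset_cell (k : ℕ) : levelSet (k + 1) ⊆ Icc (cut k) (cut (k + 1)) := by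
  rintro y ⟨hyY, hy⟩
  rcases hyY.1.eq_or_lt with h | h
  · rw [← h, returnTime_half] at hy
    obtain rfl : k = 0 := by have := Nat.cast_injective (R := ℕ∞) hy; omega
    rw [← h, ← cut_zero]
    exact left_mem_Icc.2 (monotone_cut (Nat.le_succ 0))
  rcases hyY.2.eq_or_lt with h' | h'
  · rw [h', returnTime_one] at hy
    exact absurd hy.symm (ENat.natCast_ne_top _)
  obtain ⟨m, hm⟩ := exists_mem_Ioc_cut h h'
  rw [returnTime_of_mem_Ioc hm] at hy
  obtain rfl : m = k := by have := Nat.cast_injective (R := ℕ∞) hy; omega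
  exact Ioc_subset_Icc_self hm

theorem cellLength_le_mu1_levelSet (k : ℕ) : cellLength k ≤ (mu1 (levelSet (k + 1))).toReal := by
  have hfin : mu1 (levelSet (k + 1)) ≠ ∞ :=
    ne_top_of_le_ne_top mu1_Y_lt_top.ne (measure_mono fun _ h => h.1)
  rw [← ENNReal.ofReal_le_iff_le_toReal hfin, ← cut_succ_sub, ← Real.volume_Ioc]
  exact (volume_le_mu1 measurableSet_Ioc (Ioc_subset_Icc_self.trans (cell_subset_Y k))).trans
    (measure_mono (Ioc_subset_levelSet k))

/-! ### Iterates of the transfer operator -/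

theorem abs_deriv_branch0 {x : ℝ} (hx : 0 < x) : |deriv branch0 x| = 1 / (1 + x) ^ 2 := by
  have h : HasDerivAt branch0 ((1 * (1 + x) - x * 1) / (1 + x) ^ 2) x :=
    (hasDerivAt_id x).div ((hasDerivAt_id x).const_add 1) (by positivity)
  rw [h.deriv, abs_of_nonneg]
  · congr 1; ring
  · have : 1 * (1 + x) - x * 1 = 1 := by ring
    rw [this]; positivity

theorem abs_deriv_branch1 {x : ℝ} (hx : 0 < x) : |deriv branch1 x| = 1 / (1 + x) ^ 2 := by
  have h : HasDerivAt branch1 ((0 * (1 + x) - 1 * 1) / (1 + x) ^ 2) x :=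
    (hasDerivAt_const x (1 : ℝ)).div ((hasDerivAt_id x).const_add 1) (by positivity)
  rw [h.deriv, abs_div, abs_of_pos (by positivity : 0 < (1 + x) ^ 2)]
  norm_num

theorem transferOp_apply (g : ℝ → ℂ) {x : ℝ} (hx : 0 < x) :
    transferOp g x = (1 / (1 + x) : ℝ) * g (x / (1 + x)) + (x / (1 + x) : ℝ) * g (1 / (1 + x)) := by
  have h1 : (x : ℂ) ≠ 0 := by exact_mod_cast hx.ne'
  have h2 : (1 + x : ℂ) ≠ 0 := by exact_mod_cast (by positivity : (1 + x) ≠ 0)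
  simp only [transferOp, perronFrobenius]
  rw [abs_deriv_branch0 hx, abs_deriv_branch1 hx]
  simp only [branch0, branch1, density]
  push_cast
  field_simp

/-- At each step only one preimage matters: the other leads to a point to the left of the cell
carrying `g`. At `x = 1` both preimages are `1/2`, hence the open interval. -/
theorem transferOp_iterate_apply {k : ℕ} {g : ℝ → ℂ}
    (hg : ∀ x, x ∉ Icc (cut k) (cut (k + 1)) → g x = 0) (j : ℕ) (hj : j ≤ k) :
    ∀ x ∈ Ioo (0 : ℝ) 1, transferOp^[j + 1] g x = weight j x * g (branch j x) := by
  induction j with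
  | zero =>
    intro x hx
    have h0 : g (x / (1 + x)) = 0 := hg _ fun h => by
      have h1 := (cut_mem_Y k).1.trans h.1
      rw [div_le_div_iff₀ two_pos (by linarith [hx.1])] at h1
      linarith [hx.2]
    rw [zero_add, Function.iterate_one, transferOp_apply g hx.1, h0]
    simp [weight, branch]
  | succ j ih =>
    intro x hx
    have hx1 : 0 < 1 + x := by linarith [hx.1]
    rw [Function.iterate_succ_apply', transferOp_apply _ hx.1,
      ih (by omega) (x / (1 + x)) ⟨div_pos hx.1 hx1, (div_lt_one hx1).2 (by linarith)⟩,
      ih (by omega) (1 / (1 + x)) ⟨by positivity, (div_lt_one hx1).2 (by linarith [hx.1])⟩]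
    have hy : 1 / 2 < 1 / (1 + x) := one_div_lt_one_div_of_lt hx1 (by linarith [hx.2])
    have h0 : g (branch j (1 / (1 + x))) = 0 := hg _ fun h => by
      have h1 := strictAntiOn_branch j (mem_Ioi.2 (by norm_num)) (mem_Ioi.2 (by positivity)) hy
      rw [branch_half] at h1
      exact (h1.trans_le (monotone_cut hj)).not_ge h.1
    have hb : branch j (x / (1 + x)) = branch (j + 1) x := by
      have := hx.1
      unfold branch; push_cast; field_simp; ring
    have hw : 1 / (1 + x) * weight j (x / (1 + x)) = weight (j + 1) x := by
      have := hx.1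
      unfold weight; push_cast; field_simp; ring
    rw [h0, mul_zero, mul_zero, add_zero, hb, ← mul_assoc, ← Complex.ofReal_mul, hw]

theorem firstReturnOp_apply (k : ℕ) (f : ℝ → ℂ) {x : ℝ} (hx : x ∈ Ioo (1 / 2 : ℝ) 1) :
    firstReturnOp (k + 1) f x = preOp k f x := by
  have hxY : x ∈ Y := Ioo_subset_Icc_self hx
  have h0 := pos_of_mem_Y hxY
  have hmem : branch k x ∈ closure (levelSet (k + 1)) := by
    refine subset_closure (Ioc_subset_levelSet k ⟨?_, (branch_mem_cell k hxY).2⟩)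
    rw [← branch_one]
    exact strictAntiOn_branch k h0 (mem_Ioi.2 one_pos) hx.2
  rw [firstReturnOp, indicator_of_mem hxY, transferOp_iterate_apply (k := k) (fun y hy => ?_) k le_rfl
    x ⟨h0, hx.2⟩, indicator_of_mem hmem, preOp, Complex.real_smul]
  refine indicator_of_notMem (fun h => hy ?_) _
  exact closure_minimal (levelSet_subset_cell k) isClosed_Icc h

theorem isRestriction_branchOp (k : ℕ) : IsRestriction (firstReturnOp (k + 1)) (branchOp k) := by
  intro f
  have hreg := isRightReg_branchOp k f
  have hbv := boundedVariationOn_preOp k f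
  refine ⟨mu1_absolutelyContinuous.ae_eq ?_,
    hreg.tendsto_left_one hbv (tendsto_preOp_left_one k f)⟩
  have hne : ∀ a : ℝ, ∀ᵐ x, x ≠ a := fun a => by simp [ae_iff, measure_singleton]
  filter_upwards [hreg.ae_eq hbv, hne (1 / 2), hne 1] with x hx h2 h1
  by_cases hxY : x ∈ Y
  · rw [hx hxY, firstReturnOp_apply k f ⟨hxY.1.lt_of_ne' h2, hxY.2.lt_of_ne h1⟩]
  · rw [BVY.apply_of_notMem _ hxY, firstReturnOp, indicator_of_notMem hxY]

theorem isRestriction_returnOp (n : ℕ+) : IsRestriction (firstReturnOp n) (returnOp n) := by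
  have h := isRestriction_branchOp n.natPred
  rwa [PNat.natPred_add_one] at h

theorem norm_returnOp_le (n : ℕ+) : ‖returnOp n‖ ≤ 12 * (mu1 (levelSet n)).toReal := by
  have h := cellLength_le_mu1_levelSet n.natPred
  rw [PNat.natPred_add_one] at h
  exact (norm_branchOp_le _).trans (by linarith)

/-- Off a single null set all operators agree with their representatives, and the `L¹` norm is at
most the `BV` norm times the finite mass of `Y`. -/
theorem tendsto_eLpNorm_genOp_sub {z : ℂ} (hz : ‖z‖ ≤ 1) (f : BVY) :
    Tendsto (fun N : ℕ => eLpNorm (fun x => genOp returnOp z f x -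
      ∑ n ∈ Finset.Icc 1 N, z ^ n * firstReturnOp n f x) 1 mu1) atTop (𝓝 0) := by
  have hsum : HasSum (fun k : ℕ => z ^ (k + 1) • branchOp k f) (genOp returnOp z f) :=
    (hasSum_genOp hz).mapL (ContinuousLinearMap.apply ℂ BVY f)
  have hlim := (tendsto_iff_norm_sub_tendsto_zero.1 hsum.tendsto_sum_nat)
  have hlim' : Tendsto (fun N : ℕ => ENNReal.ofReal ‖∑ k ∈ Finset.range N,
      z ^ (k + 1) • branchOp k f - genOp returnOp z f‖ * mu1 Y) atTop (𝓝 0) := by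
    have := ENNReal.Tendsto.mul_const (b := mu1 Y) (ENNReal.tendsto_ofReal hlim)
      (Or.inr mu1_Y_lt_top.ne)
    simpa using this
  refine tendsto_of_tendsto_of_tendsto_of_le_of_le tendsto_const_nhds hlim' (fun _ => zero_le)
    fun N => ?_
  have hall : ∀ᵐ x ∂mu1, ∀ k : ℕ, branchOp k f x = firstReturnOp (k + 1) f x :=
    ae_all_iff.2 fun k => (isRestriction_branchOp k f).1
  have hae : (fun x => genOp returnOp z f x - ∑ n ∈ Finset.Icc 1 N, z ^ n * firstReturnOp n f x)
      =ᵐ[mu1] ((genOp returnOp z f - ∑ k ∈ Finset.range N, z ^ (k + 1) • branchOp k f : BVY) :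
        ℝ → ℂ) := by
    filter_upwards [hall] with x hx
    have h1 : ∑ n ∈ Finset.Icc 1 N, z ^ n * firstReturnOp n f x =
        ∑ k ∈ Finset.range N, z ^ (k + 1) * firstReturnOp (k + 1) f x := by
      rw [Finset.range_eq_Ico, Finset.sum_Ico_add' (fun n => z ^ n * firstReturnOp n f x)]
      rfl
    rw [h1, BVY.coe_sub, Pi.sub_apply, ← BVY.eval_apply x (∑ k ∈ Finset.range N, _), map_sum]
    congr 1
    exact Finset.sum_congr rfl fun k _ => by rw [← hx k]; rfl
  rw [eLpNorm_congr_ae hae, norm_sub_rev]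
  exact BVY.eLpNorm_one_le _

/-! ### Contraction of the variation by `R(1)` -/

/-- The weighted average of a real function over the branches. -/
noncomputable def branchAvg (m : ℝ → ℝ) (x : ℝ) : ℝ := ∑' k, weight k x * m (branch k x)

theorem summable_weight_mul {m : ℕ → ℝ} {M : ℝ} (hM : ∀ k, |m k| ≤ M) {x : ℝ} (hx : 0 < x) :
    Summable fun k => weight k x * m k := by
  refine Summable.of_norm_bounded ((hasSum_weight hx).summable.mul_right M) fun k => ?_
  rw [norm_mul, Real.norm_of_nonneg (weight_pos k hx).le]
  exact mul_le_mul_of_nonneg_left (hM k) (weight_pos k hx).le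

theorem hasSum_branchAvg {m : ℝ → ℝ} {M : ℝ} (hM : ∀ t ∈ Y, |m t| ≤ M) {x : ℝ} (hx : x ∈ Y) :
    HasSum (fun k => weight k x * m (branch k x)) (branchAvg m x) :=
  (summable_weight_mul (fun k => hM _ (branch_mem_Y k hx)) (pos_of_mem_Y hx)).hasSum

/-- Abel summation with the tail mass placed at `m N`. The total masses agree, so equality holds for
`N = 0`; moving the tail from `m N` to `m (N + 1)` then adds a nonnegative amount. -/
theorem sum_weight_sub_mul_nonneg {m : ℕ → ℝ} (hm : Monotone m) {x y : ℝ} (hx : 0 < x)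
    (hxy : x ≤ y) (N : ℕ) :
    0 ≤ ∑ k ∈ Finset.range (N + 1), (weight k x - weight k y) * m k +
      (1 / (1 + (N + 1) * x) - 1 / (1 + (N + 1) * y)) * m N := by
  have hy : 0 < y := hx.trans_le hxy
  induction N with
  | zero =>
    rw [zero_add, Finset.sum_range_one, weight_eq_sub 0 hx, weight_eq_sub 0 hy]
    apply le_of_eq
    push_cast
    ring
  | succ N ih =>
    rw [Finset.sum_range_succ, weight_eq_sub (N + 1) hx, weight_eq_sub (N + 1) hy]
    push_cast
    have h1 : 0 ≤ 1 / (1 + ((N : ℝ) + 1) * x) - 1 / (1 + ((N : ℝ) + 1) * y) :=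
      sub_nonneg.2 (one_div_le_one_div_of_le (by positivity) (by gcongr))
    have h2 := mul_nonneg h1 (sub_nonneg.2 (hm (Nat.le_succ N)))
    linarith

theorem branchAvg_antitone {m : ℝ → ℝ} (hm : MonotoneOn m Y) {M : ℝ} (hM : ∀ t ∈ Y, |m t| ≤ M)
    {x y : ℝ} (hx : x ∈ Y) (hy : y ∈ Y) (hxy : x ≤ y) : branchAvg m y ≤ branchAvg m x := by
  have hx0 := pos_of_mem_Y hx
  have hy0 := pos_of_mem_Y hy
  have hMx : ∀ k, |m (branch k x)| ≤ M := fun k => hM _ (branch_mem_Y k hx)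
  have hs := (summable_weight_mul hMx hy0).hasSum
  -- The points are moved first, keeping the weights at `y`; the weights are then changed from `y`
  -- to `x`.
  refine (hasSum_le (fun k => ?_) (hasSum_branchAvg hM hy) hs).trans ?_
  · exact mul_le_mul_of_nonneg_left (hm (branch_mem_Y k hy) (branch_mem_Y k hx)
      (antitoneOn_branch k hx0 hy0 hxy)) (weight_pos k hy0).le
  have hmono : Monotone fun k => m (branch k x) := monotone_nat_of_le_succ fun k =>
    hm (branch_mem_Y k hx) (branch_mem_Y _ hx) (branch_le_branch k hx hx)
  have h1 : Tendsto (fun N => ∑ k ∈ Finset.range (N + 1),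
      (weight k x - weight k y) * m (branch k x)) atTop
      (𝓝 (branchAvg m x - ∑' k, weight k y * m (branch k x))) := by
    have := ((hasSum_branchAvg hM hx).sub hs).tendsto_sum_nat.comp (tendsto_add_atTop_nat 1)
    simpa only [Function.comp_def, sub_mul] using this
  have h2 : Tendsto (fun N : ℕ => (1 / (1 + ((N : ℝ) + 1) * x) - 1 / (1 + ((N : ℝ) + 1) * y)) *
      m (branch N x)) atTop (𝓝 0) := by
    have h3 := ((tendsto_inv_one_add_mul hx0).sub (tendsto_inv_one_add_mul hy0)).comp
      (tendsto_add_atTop_nat 1)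
    rw [sub_zero] at h3
    refine NormedField.tendsto_zero_smul_of_tendsto_zero_of_bounded (𝕜 := ℝ) ?_
      ⟨M, eventually_map.2 (Eventually.of_forall hMx)⟩
    simpa [Function.comp_def] using h3
  have h4 := ge_of_tendsto' (h1.add h2) fun N => sum_weight_sub_mul_nonneg hmono hx0 hxy N
  linarith

/-- The variation of `f` on `[1/2, t]`. -/
noncomputable def varTo (f : BVY) (t : ℝ) : ℝ := variationOnFromTo (f : ℝ → ℂ) Y (1 / 2) t

theorem locallyBoundedVariationOn (f : BVY) : LocallyBoundedVariationOn (f : ℝ → ℂ) Y :=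
  f.boundedVariationOn.locallyBoundedVariationOn

theorem monotoneOn_varTo (f : BVY) : MonotoneOn (varTo f) Y :=
  variationOnFromTo.monotoneOn (locallyBoundedVariationOn f) half_mem_Y

theorem abs_varTo_le (f : BVY) (t : ℝ) : |varTo f t| ≤ BVY.var f :=
  variationOnFromTo.abs_le_eVariationOn f.boundedVariationOn

theorem norm_sub_le_varTo_sub (f : BVY) {s t : ℝ} (hs : s ∈ Y) (ht : t ∈ Y) (hst : s ≤ t) :
    ‖f t - f s‖ ≤ varTo f t - varTo f s := by
  rw [varTo, varTo, variationOnFromTo.sub_right (locallyBoundedVariationOn f) half_mem_Y ht hs,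
    variationOnFromTo.eq_of_le _ _ hst, ← dist_eq_norm]
  exact (f.boundedVariationOn.mono inter_subset_left).dist_le ⟨ht, hst, le_rfl⟩ ⟨hs, le_rfl, hst⟩

theorem hasSum_preGen_one (f : BVY) {x : ℝ} (hx : x ∈ Y) :
    HasSum (fun k => (weight k x : ℂ) * f (branch k x)) (preGen 1 f x) := by
  simpa [preOp] using hasSum_preGen (z := 1) (by simp) f hx

/-- After a rotation by `c` the increment is real and nonnegative. Adding `varTo f` to the real part
of `c * f` yields an increasing function, whose average is decreasing. -/
theorem norm_preGen_one_sub_le (f : BVY) {x y : ℝ} (hx : x ∈ Y) (hy : y ∈ Y) (hxy : x ≤ y) :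
    ‖preGen 1 f y - preGen 1 f x‖ ≤ branchAvg (varTo f) x - branchAvg (varTo f) y := by
  obtain ⟨c, hc, hcD⟩ := RCLike.exists_norm_eq_mul_self (preGen 1 f y - preGen 1 f x)
  set m : ℝ → ℝ := fun t => (c * f t).re + varTo f t with hm
  have hre : ∀ t, |(c * f t).re| ≤ f.sup := fun t => by
    refine (Complex.abs_re_le_norm _).trans ?_
    rw [norm_mul, hc, one_mul]
    exact f.norm_apply_le_sup t
  have hmono : MonotoneOn m Y := fun s hs t ht hst => by
    have h1 : (c * f s).re - (c * f t).re ≤ ‖f t - f s‖ := by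
      rw [← Complex.sub_re, ← mul_sub]
      refine (Complex.re_le_norm _).trans ?_
      rw [norm_mul, hc, one_mul, norm_sub_rev]
    have h2 := norm_sub_le_varTo_sub f hs ht hst
    simp only [hm]
    linarith
  have hbd : ∀ t ∈ Y, |m t| ≤ f.sup + BVY.var f := fun t _ =>
    (abs_add_le _ _).trans (add_le_add (hre t) (abs_varTo_le f t))
  have havg : ∀ {t}, t ∈ Y →
      branchAvg m t = (c * preGen 1 f t).re + branchAvg (varTo f) t := fun {t} ht => by
    have h1 := Complex.hasSum_re ((hasSum_preGen_one f ht).mul_left c)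
    have h2 := h1.add (hasSum_branchAvg (fun s _ => abs_varTo_le f s) ht)
    refine HasSum.unique (hasSum_branchAvg hbd ht) ?_
    convert h2 using 2 with k
    rw [hm, mul_add, mul_left_comm, Complex.re_ofReal_mul]
  have hanti := branchAvg_antitone hmono hbd hx hy hxy
  rw [havg hx, havg hy] at hanti
  have h3 := congrArg Complex.re hcD
  rw [mul_sub, Complex.sub_re] at h3
  have h4 : ((‖preGen 1 f y - preGen 1 f x‖ : ℝ) : ℂ).re = ‖preGen 1 f y - preGen 1 f x‖ :=
    Complex.ofReal_re _
  have h5 : ‖preGen 1 f y - preGen 1 f x‖ = (c * preGen 1 f y).re - (c * preGen 1 f x).re :=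
    h4.symm.trans h3
  linarith

/-- The `k`-th point over `1/2` is the `(k + 1)`-st over `1`, and the remaining point over `1` is
`1/2`, where `varTo f` vanishes. The weight differences are the cell lengths, of total `1/2`. -/
theorem branchAvg_varTo_sub_le (f : BVY) :
    branchAvg (varTo f) (1 / 2) - branchAvg (varTo f) 1 ≤ 1 / 2 * BVY.var f := by
  have hb : ∀ t ∈ Y, |varTo f t| ≤ BVY.var f := fun t _ => abs_varTo_le f t
  have h1 := hasSum_branchAvg hb half_mem_Y
  have h2 := hasSum_branchAvg hb one_mem_Y
  rw [← hasSum_nat_add_iff' 1] at h2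
  have h0 : varTo f (branch 0 1) = 0 := by
    rw [branch_one, cut_zero]; exact variationOnFromTo.self _ _ _
  rw [Finset.sum_range_one, h0, mul_zero, sub_zero] at h2
  refine hasSum_le (fun k => ?_) (h1.sub h2) (hasSum_cellLength.mul_right (BVY.var f))
  rw [branch_half, branch_one, ← sub_mul]
  have hw : weight k (1 / 2) - weight (k + 1) 1 = cellLength k := by
    unfold weight cellLength; push_cast; field_simp; ring
  rw [hw]
  exact mul_le_mul_of_nonneg_left ((le_abs_self _).trans (abs_varTo_le f _)) (cellLength_pos k).le

theorem eVariationOn_preGen_one_le (f : BVY) :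
    eVariationOn (preGen 1 f) Y ≤ ENNReal.ofReal (1 / 2 * BVY.var f) := by
  have hb : ∀ t ∈ Y, |varTo f t| ≤ BVY.var f := fun t _ => abs_varTo_le f t
  have hanti : ∀ {x y}, x ∈ Y → y ∈ Y → x ≤ y → branchAvg (varTo f) y ≤ branchAvg (varTo f) x :=
    fun hx hy hxy => branchAvg_antitone (monotoneOn_varTo f) hb hx hy hxy
  refine iSup_le ?_
  rintro ⟨n, u, hu, hus⟩
  calc ∑ i ∈ Finset.range n, edist (preGen 1 f (u (i + 1))) (preGen 1 f (u i))
      ≤ ∑ i ∈ Finset.range n, ENNReal.ofReal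
          (branchAvg (varTo f) (u i) - branchAvg (varTo f) (u (i + 1))) :=
        Finset.sum_le_sum fun i _ => by
          rw [edist_dist, dist_eq_norm]
          exact ENNReal.ofReal_le_ofReal
            (norm_preGen_one_sub_le f (hus i) (hus _) (hu (Nat.le_succ i)))
    _ = ENNReal.ofReal (branchAvg (varTo f) (u 0) - branchAvg (varTo f) (u n)) := by
        rw [← ENNReal.ofReal_sum_of_nonneg fun i _ =>
          sub_nonneg.2 (hanti (hus i) (hus _) (hu (Nat.le_succ i))),
          Finset.sum_range_sub' fun i => branchAvg (varTo f) (u i)]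
    _ ≤ _ := by
        refine ENNReal.ofReal_le_ofReal ((sub_le_sub ?_ ?_).trans (branchAvg_varTo_sub_le f))
        · exact hanti half_mem_Y (hus 0) (hus 0).1
        · exact hanti (hus n) one_mem_Y (hus n).2

theorem var_genOp_one_le (f : BVY) : BVY.var (genOp returnOp 1 f) ≤ 1 / 2 * BVY.var f :=
  BVY.var_le_of_eVariationOn_le _ (mul_nonneg (by norm_num) (apply_nonneg _ _))
    ((isRightReg_genOp (by simp) f).eVariationOn_le.trans (eVariationOn_preGen_one_le f))

/-- An average of values of `f` differs from any value by at most the variation; the variation of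
the difference adds `1/2 + 1`. -/
theorem norm_genOp_one_sub_le (f : BVY) : ‖genOp returnOp 1 f - f‖ ≤ 5 / 2 * BVY.var f := by
  have h1 : (genOp returnOp 1 f - f).sup ≤ BVY.var f := by
    refine BVY.sup_le _ (apply_nonneg _ _) fun x hx => ?_
    refine (isRightReg_genOp (by simp) f).norm_sub_le (c := f x) (fun y hy => ?_) hx
    have h2 := (hasSum_preGen_one f hy).sub
      ((Complex.hasSum_ofReal.2 (hasSum_weight (pos_of_mem_Y hy))).mul_right (f x))
    rw [Complex.ofReal_one, one_mul] at h2
    rw [← h2.tsum_eq]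
    have h3 := (hasSum_weight (pos_of_mem_Y hy)).mul_right (BVY.var f)
    rw [one_mul] at h3
    refine tsum_of_norm_bounded h3 fun k => ?_
    rw [← mul_sub, norm_mul, Complex.norm_of_nonneg (weight_pos k (pos_of_mem_Y hy)).le]
    exact mul_le_mul_of_nonneg_left (f.norm_apply_sub_le_var (branch_mem_Y k hy) hx)
      (weight_pos k (pos_of_mem_Y hy)).le
  have h2 : BVY.var (genOp returnOp 1 f - f) ≤ BVY.var (genOp returnOp 1 f) + BVY.var f :=
    map_sub_le_add _ _ _
  have h3 := var_genOp_one_le f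
  rw [BVY.norm_eq]
  linarith

theorem exists_one_BVY : ∃ e : BVY, ∀ x ∈ Y, e x = 1 := by
  obtain ⟨e, he⟩ := exists_isRightReg (G := fun _ => 1) (by
    rw [BoundedVariationOn, eVariationOn.constant_on]
    · exact ENNReal.zero_ne_top
    · exact subsingleton_singleton.anti (image_subset_iff.2 fun x _ => mem_singleton (1 : ℂ)))
  exact ⟨e, fun x hx => tendsto_nhds_unique (he x hx) tendsto_const_nhds⟩

theorem isSimpleIsolatedEigenvalue_genOp_one :
    IsSimpleIsolatedEigenvalue (genOp returnOp 1) 1 := by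
  obtain ⟨e, he⟩ := exists_one_BVY
  refine isSimpleIsolatedEigenvalue_of_seminorm (genOp returnOp 1) e BVY.var ?_ ?_
    (θ := 1 / 2) (C := 5 / 2) (by norm_num) (by norm_num) (by norm_num) BVY.var_le_norm
    var_genOp_one_le norm_genOp_one_sub_le fun f hf => ⟨f 1, ?_⟩
  · rintro rfl
    exact zero_ne_one (he 1 one_mem_Y)
  · have hv : BVY.var e = 0 := by
      rw [BVY.var_def, eVariationOn.congr (f := (e : ℝ → ℂ)) (g := fun _ => 1) he,
        eVariationOn.constant_on]
      · rfl
      · exact subsingleton_singleton.anti (image_subset_iff.2 fun x _ => mem_singleton (1 : ℂ))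
    have h := norm_genOp_one_sub_le e
    rw [hv, mul_zero] at h
    exact sub_eq_zero.1 (norm_le_zero_iff.1 h)
  · refine BVY.ext fun x hx => ?_
    have h := f.norm_apply_sub_le_var hx one_mem_Y
    rw [hf] at h
    have h1 : f x = f 1 := sub_eq_zero.1 (norm_le_zero_iff.1 h)
    rw [BVY.coe_smul, Pi.smul_apply, he x hx, h1, smul_eq_mul, mul_one]

/-! ### Contraction by `R(z)` for `z ≠ 1` -/

/-- Each weight is at most `1/2` and the cell variations add up to at most the variation of `f`; the
other constant is `8` times the total cell length `1/2`. -/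
theorem var_genOp_le {z : ℂ} (hz : ‖z‖ ≤ 1) (f : BVY) :
    BVY.var (genOp returnOp z f) ≤ 1 / 2 * BVY.var f + 4 * f.sup := by
  have hsum : HasSum (fun k : ℕ => z ^ (k + 1) • branchOp k f) (genOp returnOp z f) :=
    (hasSum_genOp hz).mapL (ContinuousLinearMap.apply ℂ BVY f)
  have hlim := tendsto_iff_norm_sub_tendsto_zero.1 hsum.tendsto_sum_nat
  have hlim' := hlim.const_add (1 / 2 * BVY.var f + 4 * f.sup)
  rw [add_zero] at hlim'
  refine ge_of_tendsto' hlim' fun N => ?_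
  set S := ∑ k ∈ Finset.range N, z ^ (k + 1) • branchOp k f with hS
  have h1 : BVY.var S ≤ 1 / 2 * BVY.var f + 4 * f.sup := by
    calc BVY.var S ≤ ∑ k ∈ Finset.range N, (1 / 2 * cellVar k f + 8 * cellLength k * f.sup) := by
          refine (Finset.le_sum_of_subadditive BVY.var (map_zero BVY.var).le (map_add_le_add _) _ _).trans (Finset.sum_le_sum fun k _ => ?_)
          rw [map_smul_eq_mul]
          exact (mul_le_of_le_one_left (apply_nonneg _ _) (norm_pow_succ_le_one hz k)).trans
            (var_branchLinearMap_le k f fun x hx => weight_le_half k hx)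
      _ = 1 / 2 * ∑ k ∈ Finset.range N, cellVar k f +
            8 * (∑ k ∈ Finset.range N, cellLength k) * f.sup := by
          rw [Finset.sum_add_distrib, Finset.mul_sum, Finset.mul_sum, Finset.sum_mul]
      _ ≤ 1 / 2 * BVY.var f + 8 * (1 / 2) * f.sup := by
          have h2 := f.sup_nonneg
          gcongr
          · exact sum_cellVar_le N f
          · exact sum_le_hasSum _ (fun k _ => (cellLength_pos k).le) hasSum_cellLength
      _ = _ := by ring
  have h2 : BVY.var (genOp returnOp z f) ≤ BVY.var S + BVY.var (S - genOp returnOp z f) := by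
    have := map_sub_le_add BVY.var S (S - genOp returnOp z f)
    rwa [sub_sub_cancel] at this
  have h3 := BVY.var_le_norm (S - genOp returnOp z f)
  linarith

theorem hasSum_weight_mul (a : ℝ) {x : ℝ} (hx : x ∈ Y) : HasSum (fun k => weight k x * a) a := by
  simpa using (hasSum_weight (pos_of_mem_Y hx)).mul_right a

theorem norm_preGen_term_le_weight {z : ℂ} (hz : ‖z‖ ≤ 1) (f : BVY) {x : ℝ} (hx : x ∈ Y) (k : ℕ) :
    ‖z ^ (k + 1) * preOp k f x‖ ≤ weight k x * f.sup := by
  rw [norm_mul]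
  exact (mul_le_of_le_one_left (norm_nonneg _) (norm_pow_succ_le_one hz k)).trans
    (norm_preOp_le k f hx)

theorem sup_genOp_le {z : ℂ} (hz : ‖z‖ ≤ 1) (f : BVY) : (genOp returnOp z f).sup ≤ f.sup :=
  BVY.sup_le _ f.sup_nonneg fun _ hx => (isRightReg_genOp hz f).norm_le (fun _ hy =>
    tsum_of_norm_bounded (hasSum_weight_mul f.sup hy) (norm_preGen_term_le_weight hz f hy)) hx

theorem norm_one_add_lt_two {z : ℂ} (hz : ‖z‖ ≤ 1) (hz1 : z ≠ 1) : ‖1 + z‖ < 2 := by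
  have h1 : ‖1 + z‖ ≤ ‖(1 : ℂ)‖ + ‖z‖ := norm_add_le _ _
  rw [norm_one] at h1
  refine lt_of_le_of_ne (by linarith) fun h => hz1 ?_
  have hz' : ‖z‖ = 1 := by linarith
  have h2 : SameRay ℝ (1 : ℂ) z := sameRay_iff_norm_add.2 (by rw [h, hz', norm_one]; norm_num)
  exact (h2.eq_of_norm_eq (by rw [hz', norm_one])).symm

/-- Pigeonhole: the points `branch k x` increase with `k`, so their `N` consecutive increments sum
to at most the variation. -/
theorem exists_norm_branch_succ_sub_le (f : BVY) {x : ℝ} (hx : x ∈ Y) {N : ℕ} (hN : 0 < N) {δ : ℝ}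
    (hδ : BVY.var f ≤ N * δ) : ∃ k < N, ‖f (branch (k + 1) x) - f (branch k x)‖ ≤ δ := by
  by_contra! hlt
  have h1 : ∑ _k ∈ Finset.range N, δ <
      ∑ k ∈ Finset.range N, ‖f (branch (k + 1) x) - f (branch k x)‖ :=
    Finset.sum_lt_sum_of_nonempty (Finset.nonempty_range_iff.2 hN.ne')
      fun k hk => hlt k (Finset.mem_range.1 hk)
  rw [Finset.sum_const, Finset.card_range, nsmul_eq_mul] at h1
  have h2 := eVariationOn.sum_le (f := (f : ℝ → ℂ)) (n := N)
    (monotone_nat_of_le_succ fun k => branch_le_branch k hx hx) fun k => branch_mem_Y k hx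
  rw [f.eVariationOn_eq] at h2
  simp only [edist_dist] at h2
  rw [← ENNReal.ofReal_sum_of_nonneg fun _ _ => dist_nonneg,
    ENNReal.ofReal_le_ofReal_iff (apply_nonneg _ _)] at h2
  simp only [dist_eq_norm] at h2
  linarith

theorem norm_preGen_le_of_close {z : ℂ} (hz : ‖z‖ ≤ 1) (f : BVY) {x : ℝ} (hx : x ∈ Y) {η : ℝ}
    (hη : ‖1 + z‖ = 2 - 2 * η) {k : ℕ}
    (hk : ‖f (branch (k + 1) x) - f (branch k x)‖ ≤ η * f.sup) :
    ‖preGen z f x‖ ≤ (1 - η * weight (k + 1) x) * f.sup := by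
  have hx0 := pos_of_mem_Y hx
  set t : ℕ → ℂ := fun j => z ^ (j + 1) * preOp j f x with ht
  set g : ℕ → ℝ := fun j => weight j x * f.sup with hg
  have hgs : HasSum g f.sup := hasSum_weight_mul f.sup hx
  have hts : HasSum t (preGen z f x) := hasSum_preGen hz f hx
  set s : Finset ℕ := {k, k + 1} with hs
  have h1 := hts.summable.sum_add_tsum_compl (s := s)
  have h2 := hgs.summable.sum_add_tsum_compl (s := s)
  rw [hts.tsum_eq] at h1
  rw [hgs.tsum_eq] at h2
  have h3 : ‖∑' j : ↑((s : Set ℕ)ᶜ), t j‖ ≤ ∑' j : ↑((s : Set ℕ)ᶜ), g j :=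
    tsum_of_norm_bounded (hgs.summable.subtype _).hasSum
      fun j => norm_preGen_term_le_weight hz f hx j
  rw [hs, Finset.sum_pair (Nat.lt_succ_self k).ne] at h1 h2
  rw [← hs] at h1 h2
  have hw0 := (weight_pos (k + 1) hx0).le
  have hw := weight_succ_le k hx0
  have h4 : ‖t k + t (k + 1)‖ ≤ (weight k x + weight (k + 1) x - η * weight (k + 1) x) * f.sup := by
    -- The common mass `weight (k + 1) x` is split off from both terms, exposing the factor `1 + z`.
    -- It gains `2 * η`, of which the discrepancy of the two values costs at most `η`.
    have h5 : t k + t (k + 1) = z ^ (k + 1) * (((weight k x - weight (k + 1) x : ℝ) : ℂ) *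
        f (branch k x) + (weight (k + 1) x : ℝ) * ((1 + z) * f (branch k x)) +
        (weight (k + 1) x : ℝ) * (z * (f (branch (k + 1) x) - f (branch k x)))) := by
      simp only [ht, preOp, Complex.real_smul]
      push_cast
      ring
    rw [h5, norm_mul]
    refine (mul_le_of_le_one_left (norm_nonneg _) (norm_pow_succ_le_one hz k)).trans ?_
    refine (norm_add₃_le).trans ?_
    rw [norm_mul, norm_mul, norm_mul, norm_mul, norm_mul, Complex.norm_of_nonneg hw0,
      Complex.norm_of_nonneg (sub_nonneg.2 hw), hη]
    have hf := f.norm_apply_le_sup (branch k x)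
    have hη0 : 0 ≤ 2 - 2 * η := hη ▸ norm_nonneg _
    have h6 : ‖z‖ * ‖f (branch (k + 1) x) - f (branch k x)‖ ≤ η * f.sup :=
      (mul_le_of_le_one_left (norm_nonneg _) hz).trans hk
    calc _ ≤ (weight k x - weight (k + 1) x) * f.sup +
          weight (k + 1) x * ((2 - 2 * η) * f.sup) + weight (k + 1) x * (η * f.sup) := by
          have := sub_nonneg.2 hw
          gcongr
      _ = _ := by ring
  calc ‖preGen z f x‖ ≤ ‖t k + t (k + 1)‖ + ‖∑' j : ↑((s : Set ℕ)ᶜ), t j‖ := by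
        rw [← h1]; exact norm_add_le _ _
    _ ≤ (weight k x + weight (k + 1) x - η * weight (k + 1) x) * f.sup +
        ∑' j : ↑((s : Set ℕ)ᶜ), g j := add_le_add h4 h3
    _ = (1 - η * weight (k + 1) x) * f.sup := by
        simp only [hg] at h2 ⊢
        linarith

theorem exists_sup_genOp_le {z : ℂ} (hz : ‖z‖ ≤ 1) (hz1 : z ≠ 1) (K : ℝ) :
    ∃ ε > 0, ∀ f : BVY, BVY.var f ≤ K * f.sup → (genOp returnOp z f).sup ≤ (1 - ε) * f.sup := by
  set η : ℝ := (2 - ‖1 + z‖) / 2 with hη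
  have hη0 : 0 < η := half_pos (sub_pos.2 (norm_one_add_lt_two hz hz1))
  have hη' : ‖1 + z‖ = 2 - 2 * η := by rw [hη]; ring
  obtain ⟨N, hN⟩ := exists_nat_gt (max 0 (K / η))
  have hN0 : 0 < N := by exact_mod_cast (le_max_left _ _).trans_lt hN
  have hNK : K ≤ N * η := ((div_lt_iff₀ hη0).1 ((le_max_right _ _).trans_lt hN)).le
  -- The gain is `η` times the lower bound for `weight (k + 1)` on `Y`, at the worst index `k + 1 =
  -- N`.
  refine ⟨η * (1 / (2 * ((N + 1) * (N + 2)))), by positivity, fun f hf => ?_⟩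
  have hbound : ∀ x ∈ Y, ‖preGen z f x‖ ≤ (1 - η * (1 / (2 * ((N + 1) * (N + 2))))) * f.sup := by
    intro x hx
    obtain ⟨k, hkN, hk⟩ := exists_norm_branch_succ_sub_le f hx hN0 (δ := η * f.sup) (by
      rw [← mul_assoc]
      exact hf.trans (mul_le_mul_of_nonneg_right hNK f.sup_nonneg))
    refine (norm_preGen_le_of_close hz f hx hη' hk).trans ?_
    have h1 := half_le_weight (k + 1) hx
    have hkN' : (k : ℝ) + 1 ≤ N := by exact_mod_cast hkN
    have h2 : (1 : ℝ) / (2 * ((N + 1) * (N + 2))) ≤ 1 / (2 * (((k + 1 : ℕ) + 1) * ((k + 1 : ℕ) + 2))) := by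
      push_cast
      gcongr
    have h3 := f.sup_nonneg
    gcongr
    exact h2.trans h1
  refine BVY.sup_le _ ((norm_nonneg _).trans (hbound 1 one_mem_Y)) fun x hx => ?_
  exact (isRightReg_genOp hz f).norm_le hbound hx

theorem one_notMem_spectrum_genOp {z : ℂ} (hz : ‖z‖ ≤ 1) (hz1 : z ≠ 1) :
    (1 : ℂ) ∉ spectrum ℂ (genOp returnOp z) := by
  obtain ⟨ε, hε, hsup⟩ := exists_sup_genOp_le hz hz1 32
  rw [spectrum.notMem_iff]
  have hp0 : ∀ f : BVY, 0 ≤ max f.sup (BVY.var f / 16) := fun f => f.sup_nonneg.trans (le_max_left _ _)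
  -- Dividing the variation by `16` turns the term `4 sup` into `sup / 4`, so the variation part
  -- shrinks by `1/2 + 1/4`. If the variation exceeds `32 sup`, the supremum is below half the
  -- gauge; otherwise it shrinks by `1 - ε`.
  refine isUnit_algebraMap_sub_of_contraction _ (fun f => max f.sup (BVY.var f / 16)) (A := 1)
    (B := 17) (θ := max (1 - ε) (3 / 4)) (by norm_num) (fun f => ?_) (fun f => ?_)
    (le_max_of_le_right (by norm_num)) (fun f => ?_) ?_
  · have h1 := f.sup_le_norm
    have h2 := f.var_le_norm
    rw [one_mul]
    exact max_le h1 (by linarith [norm_nonneg f])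
  · have h1 := le_max_left f.sup (BVY.var f / 16)
    have h2 := le_max_right f.sup (BVY.var f / 16)
    rw [BVY.norm_eq]
    linarith
  · have h1 := le_max_left f.sup (BVY.var f / 16)
    have h2 := le_max_right f.sup (BVY.var f / 16)
    have h3 : 3 / 4 * max f.sup (BVY.var f / 16) ≤
        max (1 - ε) (3 / 4) * max f.sup (BVY.var f / 16) :=
      mul_le_mul_of_nonneg_right (le_max_right _ _) (hp0 f)
    refine max_le ?_ ?_
    · rcases le_or_gt (BVY.var f) (32 * f.sup) with h | h
      · calc (genOp returnOp z f).sup ≤ (1 - ε) * f.sup := hsup f h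
          _ ≤ max (1 - ε) (3 / 4) * f.sup :=
            mul_le_mul_of_nonneg_right (le_max_left _ _) f.sup_nonneg
          _ ≤ _ := mul_le_mul_of_nonneg_left h1 (le_max_of_le_right (by norm_num))
      · have h4 := sup_genOp_le hz f
        linarith [hp0 f]
    · have h4 := var_genOp_le hz f
      linarith
  · rw [norm_one]
    exact max_lt (by linarith) (by norm_num)

end Farey

open Farey in
theorem mainTheorem5 :
    -- `BV(Y)` is a Banach space of `μ₁`-integrable functions
    CompleteSpace BVY ∧ (∀ f : BVY, Integrable (f : ℝ → ℂ) mu1) ∧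
    -- the first return time operators act on it as bounded linear operators
    ∃ R : ℕ+ → BVY →L[ℂ] BVY, (∀ n : ℕ+, IsRestriction (firstReturnOp n) (R n)) ∧
      -- the series defining `R(z)` converges in operator norm on `BV(Y)`, and in `L¹(μ₁)`
      (∀ z : ℂ, ‖z‖ ≤ 1 → Summable (fun n : ℕ+ => z ^ (n : ℕ) • R n) ∧
        ∀ f : BVY, Tendsto (fun N : ℕ => eLpNorm (fun x => genOp R z f x -
          ∑ n ∈ Finset.Icc 1 N, z ^ n * firstReturnOp n f x) 1 mu1) atTop (𝓝 0)) ∧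
      -- (R1) (that `R(1)` preserves `BV(Y)` is the case `z = 1` of the previous clause)
      (∀ f : BVY, MemLp (f : ℝ → ℂ) ∞ (volume.restrict (Icc (0 : ℝ) 1))) ∧
      -- (R2)
      (∀ f : BVY, eLpNorm (f : ℝ → ℂ) ∞ (volume.restrict (Icc (0 : ℝ) 1)) ≤
        ENNReal.ofReal ‖f‖) ∧
      -- (R3)
      (∃ C : ℝ, 0 < C ∧ ∀ n : ℕ+, ‖R n‖ ≤ C * (mu1 (levelSet n)).toReal) ∧
      -- (R4)
      IsSimpleIsolatedEigenvalue (genOp R 1) 1 ∧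
      -- (R5)
      (∀ z : ℂ, ‖z‖ ≤ 1 → z ≠ 1 → (1 : ℂ) ∉ spectrum ℂ (genOp R z)) :=
  ⟨inferInstance, BVY.integrable, returnOp, isRestriction_returnOp,
    fun _ hz => ⟨summable_returnOp hz, tendsto_eLpNorm_genOp_sub hz⟩, BVY.memLp_top,
    BVY.eLpNorm_top_le, ⟨12, by norm_num, norm_returnOp_le⟩, isSimpleIsolatedEigenvalue_genOp_one,
    fun _ hz hz1 => one_notMem_spectrum_genOp hz hz1⟩
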